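/- Fix $\alpha>0$, $\kappa_0>0$, $\kappa>0$ and $m\in(-1,1)$, and put $M=\lfloor \alpha N\rfloor$. For each $N$, let $\bm x_0$ be uniform on $\{-1,+1\}^N$, let $\bm w=(w_a)_{a=1}^M$ have independent coordinates distributed as $N(0,1)$ conditioned to be at most $\kappa_0$ in absolute value, and let $\tilde{\bm g}_1,\dots,\tilde{\bm g}_M$ be independent $N(0,\bm I_N)$ vectors, with $\bm x_0,\bm w,(\tilde{\bm g}_a)_a$ independent. The planted constraint vectors are $$\bm g_a=\tfrac1{\sqrt N}\,w_a\,\bm x_0+\big(\bm I-\tfrac1N\bm x_0\bm x_0^\top\big)\tilde{\bm g}_a,\qquad 1\le a\le M.$$ For $r\in[0,1]$ with $Nr\in\mathbb Z$, let $Z(\bm x_0,\kappa,r)$ be the number of $\bm y\in\{-1,+1\}^N$ at Hamming distance $Nr$ from $\bm x_0$ such that $|\langle \bm g_a,\bm y\rangle|\le\kappa\sqrt N$ for all $a$. Let $$h(m)=-\tfrac{1+m}2\log\tfrac{1+m}2-\tfrac{1-m}2\log\tfrac{1-m}2,\qquad \varphi_1(m)=\mathbb E\log\mathbb P\big(|mZ_0+\sqrt{1-m^2}\,Z|\le\kappa\,\big|\,Z_0\big),$$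 $$\varphi_2(m,q)=\mathbb E\log\mathbb P\big(|mZ_0+Z_1|\le\kappa,\ |mZ_0+Z_2|\le\kappa\,\big|\,Z_0\big),$$ where $Z_0$ is distributed as $N(0,1)$ conditioned on $|Z_0|\le\kappa_0$, $Z\sim N(0,1)$ is independent of $Z_0$, and $(Z_1,Z_2)$ is a centered Gaussian vector, independent of $Z_0$, with $\mathbb E Z_1^2=\mathbb E Z_2^2=1-m^2$ and $\mathbb E Z_1Z_2=q-m^2$. Let the planted models for all $N$ be defined on one probability space (with any joint law across different $N$), and let $r_N\in[0,1]$ with $Nr_N\in\mathbb Z$ and $r_N\to r=(1-m)/2$ (for instance $r_N=\lfloor Nr\rfloor/N$, which equals $r$ whenever $Nr$ is an integer). Then, almost surely as $N\to\infty$, both conditional expectations below are eventually positive and $$\frac1N\log\mathbb E\big[Z(\bm x_0,\kappa,r_N)\,\big|\,\bm w\big]\longrightarrow h(m)+\alpha\varphi_1(m),$$ $$\frac1N\log\mathbb E\big[Z(\bm x_0,\kappa,r_N)^2\,\big|\,\bm w\big]\longrightarrow\max_{q\in[-1,1]}\Big\{\max_{(\theta_1,\theta_2)}h(\theta_1,\theta_2)+\alpha\varphi_2(m,q)\Big\},$$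 where $h(\theta_1,\theta_2)$ is Shannon entropy, the inner maximum is over the joint distributions of two $\{-1,+1\}$-valued random variables with $\mathbb E\theta_1=\mathbb E\theta_2=m$ and $\mathbb E[\theta_1\theta_2]=q$, and the outer maximum, which is attained, is over those $q$ for which such a joint distribution exists. -/

import Mathlib

open MeasureTheory ProbabilityTheory Filter Topology Matrix

noncomputable section

namespace SBP

/-- The hypercube `{-1,+1}^N`, as a set of vectors of `ℝ^N`. -/
def hypercube (N : ℕ) : Set (Fin N → ℝ) := {x | ∀ i, x i = 1 ∨ x i = -1}

/-- The solution set `S(G, κ)` of the symmetric binary perceptron with constraint vectors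
`G a`, `a : Fin M`: all `x ∈ {-1,+1}^N` such that `|⟨g_a, x⟩| ≤ κ √N` for all `a`. -/
def solutions {N M : ℕ} (G : Fin M → Fin N → ℝ) (κ : ℝ) : Set (Fin N → ℝ) :=
  {x | x ∈ hypercube N ∧ ∀ a, |G a ⬝ᵥ x| ≤ κ * √(N : ℝ)}

/-- The local partition function `Z(x₀, κ, r)`: the number of solutions at Hamming distance
exactly `N r` from `x₀`. -/
def localZ {N M : ℕ} (G : Fin M → Fin N → ℝ) (x₀ : Fin N → ℝ) (κ r : ℝ) : ℕ :=
  {y | y ∈ solutions G κ ∧ (hammingDist x₀ y : ℝ) = N * r}.ncard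

/-- The law of a standard normal variable conditioned to be at most `κ₀` in absolute value. -/
def truncGaussian (κ₀ : ℝ) : Measure ℝ := (gaussianReal 0 1)[|{z : ℝ | |z| ≤ κ₀}]

/-- The planted constraint vectors `g_a = N^{-1/2} w_a x₀ + (I - N^{-1} x₀ x₀ᵀ) g̃_a`. -/
def plantedG {N M : ℕ} (x₀ : Fin N → ℝ) (w : Fin M → ℝ) (g : Fin M → Fin N → ℝ) :
    Fin M → Fin N → ℝ :=
  fun a => (w a / √(N : ℝ)) • x₀ + (1 - (1 / (N : ℝ)) • vecMulVec x₀ x₀) *ᵥ g a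

/-- `(x₀, w, g)` are the random data of a planted model of size `(N, M)` at margin `κ₀`:
`x₀` is uniform on `{-1,+1}^N`, the `w_a` are truncated standard normals, the `g_a` (denoted
`g̃_a` in the usual notation) are standard Gaussian vectors of `ℝ^N`, and all of these are independent. -/
structure IsPlanted {Ω : Type*} [MeasurableSpace Ω] (P : Measure Ω) (κ₀ : ℝ) {N M : ℕ}
    (x₀ : Ω → Fin N → ℝ) (w : Ω → Fin M → ℝ) (g : Ω → Fin M → Fin N → ℝ) : Prop where
  measurable_x₀ : Measurable x₀
  measurable_w : Measurable w
  measurable_g : Measurable g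
  map_eq : P.map (fun ω => (x₀ ω, w ω, g ω)) =
    (uniformOn (hypercube N)).prod
      ((Measure.pi fun _ : Fin M => truncGaussian κ₀).prod
        (Measure.pi fun _ : Fin M => Measure.pi fun _ : Fin N => gaussianReal 0 1))

/-- The conditional expectation `E[Z(x₀, κ, r)^k | w]` in the planted model. -/
def condMoment {Ω : Type*} [MeasurableSpace Ω] (P : Measure Ω) {N M : ℕ}
    (x₀ : Ω → Fin N → ℝ) (w : Ω → Fin M → ℝ) (g : Ω → Fin M → Fin N → ℝ)
    (κ r : ℝ) (k : ℕ) : Ω → ℝ :=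
  P[fun ω => (localZ (plantedG (x₀ ω) (w ω) (g ω)) (x₀ ω) κ r : ℝ) ^ k |
    MeasurableSpace.comap w inferInstance]

/-- The binary entropy function `h(m)` (natural logarithm). -/
def h (m : ℝ) : ℝ :=
  -((1 + m) / 2) * Real.log ((1 + m) / 2) - ((1 - m) / 2) * Real.log ((1 - m) / 2)

/-- `φ₁(m) = E log P(|m Z₀ + √(1-m²) Z| ≤ κ | Z₀)`, with `Z₀` a truncated standard normal and
`Z` an independent standard normal. -/
def phi1 (κ₀ κ m : ℝ) : ℝ :=
  ∫ z₀, Real.log ((gaussianReal 0 1).real {z : ℝ | |m * z₀ + √(1 - m ^ 2) * z| ≤ κ})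
    ∂(truncGaussian κ₀)

/-- `φ₂(m,q) = E log P(|m Z₀ + Z₁| ≤ κ, |m Z₀ + Z₂| ≤ κ | Z₀)`, with `Z₀` a truncated standard
normal and `(Z₁, Z₂)` an independent centered Gaussian vector with variances `1 - m²` and
covariance `q - m²`. -/
def phi2 (κ₀ κ m q : ℝ) : ℝ :=
  ∫ z₀, Real.log ((multivariateGaussian 0
      !![1 - m ^ 2, q - m ^ 2; q - m ^ 2, 1 - m ^ 2]).real
        {z : EuclideanSpace ℝ (Fin 2) | |m * z₀ + z 0| ≤ κ ∧ |m * z₀ + z 1| ≤ κ})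
    ∂(truncGaussian κ₀)

/-- The probability mass functions `p` on `{-1,+1}²` of the pairs `(θ₁, θ₂)` with
`E θ₁ = E θ₂ = m` and `E θ₁θ₂ = q`. -/
def pairLaws (m q : ℝ) : Set (ℤˣ × ℤˣ → ℝ) :=
  {p | p ∈ stdSimplex ℝ (ℤˣ × ℤˣ) ∧
    ∑ e, p e * ((e.1 : ℤ) : ℝ) = m ∧
    ∑ e, p e * ((e.2 : ℤ) : ℝ) = m ∧
    ∑ e, p e * (((e.1 : ℤ) : ℝ) * ((e.2 : ℤ) : ℝ)) = q}

/-- The Shannon entropy `-∑ p log p` (natural logarithm). -/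
def entropy (p : ℤˣ × ℤˣ → ℝ) : ℝ := ∑ e, Real.negMulLog (p e)

/-- The values `max_{(θ₁,θ₂)} h(θ₁,θ₂) + α φ₂(m,q)`, where `q` runs over the points of `[-1,1]`
for which there is a pair `(θ₁,θ₂)` with means `m` and correlation `q`. -/
def secondMomentValues (α κ₀ κ m : ℝ) : Set ℝ :=
  {v | ∃ q ∈ Set.Icc (-1 : ℝ) 1, ∃ s, IsGreatest (entropy '' pairLaws m q) s ∧
    v = s + α * phi2 κ₀ κ m q}

end SBP

end

/-! The points at distance `d` from `x₀` are the sign flips of `x₀` along `d`-subsets `D`. Put `ρ =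
d/N` and `m = 1 - 2ρ`. Constraint `a` on the flip reads `|m w_a + Z| ≤ κ`, where `Z` pairs `g̃_a`
with the normalized component of the flip orthogonal to `x₀`. For two subsets with overlap `k = tN`,
the two such variables form a centered Gaussian pair with variances `1 - m²` and covariance `q -
m²`, `q = 1 - 4(ρ - t)`. This law depends only on `(ρ, t)`, so integrating out `g̃` and `x₀` leaves
explicit functions of `w`: the second conditional moment is `∑ k, pairCount N d k * ∏ a, flipProb κ
(ρ, k/N) (w a)`, and the first is its term `k = d` (`integral_flipCount_sq`, `integral_flipCount`).

Each term has exponential rate `pairRate`: factorial bounds turn `pairCount` into an entropy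
(`abs_log_pairCount_sub_le`), and a law of large numbers turns the averaged logarithms into an
integral. The latter must hold uniformly in `(ρ, t)`, since `d/N` only converges to its limit and
the number of overlaps grows with `N`. Uniformity comes from compactness (`ae_uniform_row_average`),
because `log flipProb` is jointly continuous (`continuousOn_log_flipProb`), degenerate covariances
included. Hoeffding's inequality and Borel–Cantelli give almost sure convergence whatever the joint
law across different `N`.

A sum of at most `N + 1` terms grows like its largest one (`tendsto_log_sum`), so the second moment
has rate `max_t pairRate (ρ, t)`. Finally, `m` and `q` determine the law of a pair of signs, so the
inner maximum of the theorem is over a single law and the two variational problems agree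
(`mem_secondMomentValues_iff`). -/

noncomputable section

namespace SBP

/-! ### Gaussian pairs as linear images of standard Gaussian vectors -/

/-- The standard Gaussian measure on `ι → ℝ`. -/
def stdPi (ι : Type*) [Fintype ι] : Measure (ι → ℝ) := Measure.pi fun _ => gaussianReal 0 1

instance (ι : Type*) [Fintype ι] : IsProbabilityMeasure (stdPi ι) := by
  unfold stdPi; infer_instance

/-- The Gram matrix of a pair of vectors. -/
def gram₂ {ι : Type*} [Fintype ι] (a b : ι → ℝ) : Matrix (Fin 2) (Fin 2) ℝ :=
  !![a ⬝ᵥ a, a ⬝ᵥ b; a ⬝ᵥ b, b ⬝ᵥ b]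

lemma gram₂_posSemidef {ι : Type*} [Fintype ι] (a b : ι → ℝ) : (gram₂ a b).PosSemidef := by
  have h := Matrix.posSemidef_self_mul_conjTranspose (Matrix.of ![a, b] : Matrix (Fin 2) ι ℝ)
  convert h using 1
  ext i j
  fin_cases i <;> fin_cases j <;>
    simp [gram₂, Matrix.mul_apply, dotProduct, mul_comm]

lemma measurable_pairMap {ι : Type*} [Fintype ι] (a b : ι → ℝ) :
    Measurable fun g : ι → ℝ => !₂[a ⬝ᵥ g, b ⬝ᵥ g] := by
  refine (WithLp.measurable_toLp 2 _).comp (measurable_pi_lambda _ fun i => ?_)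
  fin_cases i <;> simp [dotProduct] <;> fun_prop

/-- A pair of linear functionals of a standard Gaussian vector is Gaussian, with the Gram matrix
as covariance. -/
lemma map_stdPi_pair {ι : Type*} [Fintype ι] (a b : ι → ℝ) :
    (stdPi ι).map (fun g => !₂[a ⬝ᵥ g, b ⬝ᵥ g]) = multivariateGaussian 0 (gram₂ a b) := by
  classical
  have hm := measurable_pairMap a b
  have : IsProbabilityMeasure ((stdPi ι).map (fun g => !₂[a ⬝ᵥ g, b ⬝ᵥ g])) :=
    Measure.isProbabilityMeasure_map hm.aemeasurable
  apply Measure.ext_of_charFun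
  ext t
  rw [charFun_multivariateGaussian (gram₂_posSemidef a b), charFun_apply,
    integral_map hm.aemeasurable (by fun_prop)]
  -- Both characteristic functions at `t` reduce to that of the standard Gaussian at the single
  -- vector `t 0 • a + t 1 • b`.
  have h1 := charFun_stdGaussian (E := EuclideanSpace ℝ ι) (WithLp.toLp 2 (t 0 • a + t 1 • b))
  rw [← map_pi_eq_stdGaussian, charFun_apply,
    integral_map (WithLp.measurable_toLp 2 _).aemeasurable (by fun_prop)] at h1
  have e1 : ∀ g : ι → ℝ, inner ℝ (!₂[a ⬝ᵥ g, b ⬝ᵥ g] : EuclideanSpace ℝ (Fin 2)) t =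
      inner ℝ (WithLp.toLp 2 g) (WithLp.toLp 2 (t 0 • a + t 1 • b)) := by
    intro g
    simp [PiLp.inner_apply, dotProduct, Fin.sum_univ_two, add_mul, Finset.sum_add_distrib,
      Finset.mul_sum]
    congr 1 <;> exact Finset.sum_congr rfl fun i _ => by ring
  simp only [stdPi, e1]
  rw [h1]
  have e2 : ‖(WithLp.toLp 2 (t 0 • a + t 1 • b) : EuclideanSpace ℝ ι)‖ ^ 2 =
      t.ofLp ⬝ᵥ gram₂ a b *ᵥ t.ofLp := by
    rw [EuclideanSpace.real_norm_sq_eq]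
    simp only [gram₂, dotProduct, mulVec, Fin.sum_univ_two]
    simp [add_sq, mul_pow, Finset.sum_add_distrib, Finset.sum_mul, Finset.mul_sum, mul_add]
    simp only [← Finset.sum_add_distrib]
    exact Finset.sum_congr rfl fun i _ => by ring
  rw [← Complex.ofReal_pow, e2]
  simp
  ring_nf

/-- The conditional probability `P(|m w + Z₁| ≤ κ, |m w + Z₂| ≤ κ)` for a centered Gaussian pair
with variances `1 - m²` and covariance `q - m²`. -/
def pairProb (κ m q w : ℝ) : ℝ :=
  (multivariateGaussian 0 !![1 - m ^ 2, q - m ^ 2; q - m ^ 2, 1 - m ^ 2]).real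
    {z : EuclideanSpace ℝ (Fin 2) | |m * w + z 0| ≤ κ ∧ |m * w + z 1| ≤ κ}

/-- Only the Gram matrix of `a, b` matters, so the same probability can be realized in any
dimension: `ℝ^N` for flips, `ℝ²` for continuity and positivity, `ℝ` when `q = 1`. -/
lemma pairProb_eq_stdPi {ι : Type*} [Fintype ι] (a b : ι → ℝ) {κ m q w : ℝ}
    (ha : a ⬝ᵥ a = 1 - m ^ 2) (hb : b ⬝ᵥ b = 1 - m ^ 2) (hab : a ⬝ᵥ b = q - m ^ 2) :
    pairProb κ m q w =
      (stdPi ι).real {g | |m * w + a ⬝ᵥ g| ≤ κ ∧ |m * w + b ⬝ᵥ g| ≤ κ} := by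
  have hG : gram₂ a b = !![1 - m ^ 2, q - m ^ 2; q - m ^ 2, 1 - m ^ 2] := by
    rw [gram₂, ha, hb, hab]
  rw [pairProb, ← hG, ← map_stdPi_pair, map_measureReal_apply (measurable_pairMap a b)]
  · rfl
  · have h0 : Measurable fun z : EuclideanSpace ℝ (Fin 2) => |m * w + z 0| := by fun_prop
    have h1 : Measurable fun z : EuclideanSpace ℝ (Fin 2) => |m * w + z 1| := by fun_prop
    exact (measurableSet_le h0 measurable_const).inter (measurableSet_le h1 measurable_const)

lemma map_stdPi_dotProduct {ι : Type*} [Fintype ι] (a : ι → ℝ) :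
    (stdPi ι).map (fun g => a ⬝ᵥ g) = gaussianReal 0 (a ⬝ᵥ a).toNNReal := by
  have h := (measurePreserving_eval_multivariateGaussian (μ := 0) (gram₂_posSemidef a a)
    (i := 0)).map_eq
  rw [← map_stdPi_pair, Measure.map_map (by fun_prop) (measurable_pairMap a a)] at h
  simpa [gram₂, Function.comp_def] using h

lemma stdPi_dotProduct_eq_null {ι : Type*} [Fintype ι] (a : ι → ℝ) (ha : a ⬝ᵥ a ≠ 0) (c : ℝ) :
    ∀ᵐ g ∂(stdPi ι), a ⬝ᵥ g ≠ c := by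
  have hp : 0 < a ⬝ᵥ a := lt_of_le_of_ne (by
    simp only [dotProduct]; exact Finset.sum_nonneg fun i _ => mul_self_nonneg _) ha.symm
  have hm : Measurable fun g : ι → ℝ => a ⬝ᵥ g := by unfold dotProduct; fun_prop
  have : ∀ᵐ x ∂((stdPi ι).map (fun g => a ⬝ᵥ g)), x ≠ c := by
    rw [map_stdPi_dotProduct, ae_iff]
    have := nullSingletonClass_gaussianReal (μ := 0) (v := (a ⬝ᵥ a).toNNReal) (by simpa using hp)
    simp
  exact ae_of_ae_map hm.aemeasurable this

lemma pairProb_one {κ m : ℝ} (hm : m ^ 2 ≤ 1) (w : ℝ) :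
    pairProb κ m 1 w =
      (gaussianReal 0 1).real {z : ℝ | |m * w + √(1 - m ^ 2) * z| ≤ κ} := by
  have h2 : (fun _ : Unit => √(1 - m ^ 2)) ⬝ᵥ (fun _ : Unit => √(1 - m ^ 2)) = 1 - m ^ 2 := by
    simp [Real.mul_self_sqrt (sub_nonneg.2 hm)]
  rw [pairProb_eq_stdPi (fun _ : Unit => √(1 - m ^ 2)) (fun _ : Unit => √(1 - m ^ 2)) h2 h2 h2]
  have hmp : MeasurePreserving (fun g : Unit → ℝ => g ()) (stdPi Unit) (gaussianReal 0 1) :=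
    measurePreserving_eval _ ()
  have hS : MeasurableSet {z : ℝ | |m * w + √(1 - m ^ 2) * z| ≤ κ} :=
    measurableSet_le (by fun_prop) measurable_const
  rw [← hmp.measureReal_preimage hS.nullMeasurableSet]
  congr 1
  ext g
  simp

/-! ### Positivity and continuity of the pair probability -/

/-- The pairs `(ρ, t)` such that `t`, `ρ - t`, `ρ - t`, `1 - 2 ρ + t` is a probability vector with
`0 < ρ < 1`. -/
def admissible : Set (ℝ × ℝ) :=
  {p | 0 < p.1 ∧ p.1 < 1 ∧ 0 ≤ p.2 ∧ p.2 ≤ p.1 ∧ 2 * p.1 - 1 ≤ p.2}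

/-- `pairProb` in terms of the Hamming distance `ρ` and the overlap `t` of the flipped sets. -/
def flipProb (κ : ℝ) (p : ℝ × ℝ) (w : ℝ) : ℝ :=
  pairProb κ (1 - 2 * p.1) (1 - 4 * (p.1 - p.2)) w

/-- Together with `diffCoeff`, the standard deviations of the independent variables `(Z₁ + Z₂)/2`
and `(Z₁ - Z₂)/2`. Unlike a Cholesky factor, these coefficients stay continuous where the covariance
degenerates. -/
def sumCoeff (p : ℝ × ℝ) : ℝ := √(2 * p.1 + 2 * p.2 - 4 * p.1 ^ 2)

def diffCoeff (p : ℝ × ℝ) : ℝ := √(2 * (p.1 - p.2))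

/-- The binding constraint is `t ≥ 0` for `ρ ≤ 1/2`, where the expression is at least `2ρ(1 - 2ρ)`,
and `t ≥ 2ρ - 1` for `ρ ≥ 1/2`, where it is at least `2(2ρ - 1)(1 - ρ)`. -/
lemma sumCoeff_arg_nonneg {p : ℝ × ℝ} (hp : p ∈ admissible) :
    0 ≤ 2 * p.1 + 2 * p.2 - 4 * p.1 ^ 2 := by
  obtain ⟨h0, h1, h2, h3, h4⟩ := hp
  rcases le_total p.1 (1 / 2) with h | h
  · nlinarith
  · nlinarith

lemma sumCoeff_arg_pos {p : ℝ × ℝ} (hp : p ∈ admissible) (hm : 1 - 2 * p.1 ≠ 0) :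
    0 < 2 * p.1 + 2 * p.2 - 4 * p.1 ^ 2 := by
  obtain ⟨h0, h1, h2, h3, h4⟩ := hp
  rcases lt_or_gt_of_ne hm with h | h
  · nlinarith [mul_pos (sub_pos.2 h1) (neg_pos.2 h)]
  · nlinarith [mul_pos h0 h]

lemma sumCoeff_mul_self {p : ℝ × ℝ} (hp : p ∈ admissible) :
    sumCoeff p * sumCoeff p = 2 * p.1 + 2 * p.2 - 4 * p.1 ^ 2 :=
  Real.mul_self_sqrt (sumCoeff_arg_nonneg hp)

lemma diffCoeff_mul_self {p : ℝ × ℝ} (hp : p ∈ admissible) :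
    diffCoeff p * diffCoeff p = 2 * (p.1 - p.2) :=
  Real.mul_self_sqrt (by linarith [hp.2.2.2.1])

lemma flipProb_eq {κ : ℝ} {p : ℝ × ℝ} (hp : p ∈ admissible) (w : ℝ) :
    flipProb κ p w = (stdPi (Fin 2)).real
      {g | |(1 - 2 * p.1) * w + ![sumCoeff p, diffCoeff p] ⬝ᵥ g| ≤ κ ∧
        |(1 - 2 * p.1) * w + ![sumCoeff p, -diffCoeff p] ⬝ᵥ g| ≤ κ} := by
  have hs := sumCoeff_mul_self hp
  have hd := diffCoeff_mul_self hp
  apply pairProb_eq_stdPi <;> simp [dotProduct, Fin.sum_univ_two] <;> nlinarith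

lemma continuous_abs_add_dotProduct (c : ℝ) (a : Fin 2 → ℝ) :
    Continuous fun g : Fin 2 → ℝ => |c + a ⬝ᵥ g| := by
  unfold dotProduct
  fun_prop

/-- The strict inequalities define an open set, so one point of it suffices. The pair may be
degenerate, but the common shift `m w` can always be cancelled: either `m = 0`, or the sum direction
has positive variance. -/
lemma flipProb_pos {κ : ℝ} (hκ : 0 < κ) {p : ℝ × ℝ} (hp : p ∈ admissible) (w : ℝ) :
    0 < flipProb κ p w := by
  rw [flipProb_eq hp]
  have hop : (stdPi (Fin 2)).IsOpenPosMeasure := by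
    have : (gaussianReal 0 1).IsOpenPosMeasure :=
      (gaussianReal_absolutelyContinuous' 0 one_ne_zero).isOpenPosMeasure
    unfold stdPi
    infer_instance
  have ho : IsOpen {g : Fin 2 → ℝ | |(1 - 2 * p.1) * w + ![sumCoeff p, diffCoeff p] ⬝ᵥ g| < κ ∧
      |(1 - 2 * p.1) * w + ![sumCoeff p, -diffCoeff p] ⬝ᵥ g| < κ} :=
    (isOpen_lt (continuous_abs_add_dotProduct _ _) continuous_const).inter
      (isOpen_lt (continuous_abs_add_dotProduct _ _) continuous_const)
  have hne : {g : Fin 2 → ℝ | |(1 - 2 * p.1) * w + ![sumCoeff p, diffCoeff p] ⬝ᵥ g| < κ ∧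
      |(1 - 2 * p.1) * w + ![sumCoeff p, -diffCoeff p] ⬝ᵥ g| < κ}.Nonempty := by
    by_cases hm : 1 - 2 * p.1 = 0
    · exact ⟨0, by simp [hm, hκ]⟩
    · have hs : 0 < sumCoeff p := Real.sqrt_pos.2 (sumCoeff_arg_pos hp hm)
      refine ⟨![-((1 - 2 * p.1) * w) / sumCoeff p, 0], ?_⟩
      have : sumCoeff p * (-((1 - 2 * p.1) * w) / sumCoeff p) = -((1 - 2 * p.1) * w) := by
        field_simp
      simp [dotProduct, Fin.sum_univ_two, this, hκ]
  have hpos := ho.measure_pos (stdPi (Fin 2)) hne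
  refine ENNReal.toReal_pos (ne_of_gt (hpos.trans_le (measure_mono ?_))) (measure_ne_top _ _)
  exact fun g hg => ⟨hg.1.le, hg.2.le⟩

/-- Each of the two functionals separately has variance `4ρ(1 - ρ) > 0`, so it almost surely misses
the boundary values `±κ`, even if the pair is degenerate. Off that null set the indicator of the
event is locally constant in the parameters. -/
lemma continuousOn_flipProb (κ : ℝ) :
    ContinuousOn (fun x : (ℝ × ℝ) × ℝ => flipProb κ x.1 x.2) (admissible ×ˢ Set.univ) := by
  have hA : ∀ y : (ℝ × ℝ) × ℝ, MeasurableSet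
      {g : Fin 2 → ℝ | |(1 - 2 * y.1.1) * y.2 + ![sumCoeff y.1, diffCoeff y.1] ⬝ᵥ g| ≤ κ ∧
        |(1 - 2 * y.1.1) * y.2 + ![sumCoeff y.1, -diffCoeff y.1] ⬝ᵥ g| ≤ κ} := fun y =>
    (measurableSet_le (continuous_abs_add_dotProduct _ _).measurable measurable_const).inter
      (measurableSet_le (continuous_abs_add_dotProduct _ _).measurable measurable_const)
  intro x hx
  have hp := hx.1
  have hs := sumCoeff_mul_self hp
  have hd := diffCoeff_mul_self hp
  have hpos : 0 < 4 * (x.1.1 * (1 - x.1.1)) :=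
    mul_pos (by norm_num) (mul_pos hp.1 (by linarith [hp.2.1]))
  suffices h : ContinuousAt (fun x : (ℝ × ℝ) × ℝ => (stdPi (Fin 2)).real
      {g | |(1 - 2 * x.1.1) * x.2 + ![sumCoeff x.1, diffCoeff x.1] ⬝ᵥ g| ≤ κ ∧
        |(1 - 2 * x.1.1) * x.2 + ![sumCoeff x.1, -diffCoeff x.1] ⬝ᵥ g| ≤ κ}) x from
    h.continuousWithinAt.congr (fun y hy => flipProb_eq hy.1 y.2) (flipProb_eq hp x.2)
  refine (ENNReal.tendsto_toReal (measure_ne_top _ _)).comp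
    (tendsto_measure_of_ae_tendsto_indicator_of_isFiniteMeasure (𝓝 x) (hA x) hA ?_)
  have n1 := stdPi_dotProduct_eq_null ![sumCoeff x.1, diffCoeff x.1]
    (by simp [dotProduct, Fin.sum_univ_two, hs, hd]; nlinarith)
  have n2 := stdPi_dotProduct_eq_null ![sumCoeff x.1, -diffCoeff x.1]
    (by simp [dotProduct, Fin.sum_univ_two, hs, hd]; nlinarith)
  have c1 : ∀ g : Fin 2 → ℝ, Continuous fun y : (ℝ × ℝ) × ℝ =>
      |(1 - 2 * y.1.1) * y.2 + ![sumCoeff y.1, diffCoeff y.1] ⬝ᵥ g| := by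
    intro g
    simp only [dotProduct, Fin.sum_univ_two, sumCoeff, diffCoeff]
    simp
    fun_prop
  have c2 : ∀ g : Fin 2 → ℝ, Continuous fun y : (ℝ × ℝ) × ℝ =>
      |(1 - 2 * y.1.1) * y.2 + ![sumCoeff y.1, -diffCoeff y.1] ⬝ᵥ g| := by
    intro g
    simp only [dotProduct, Fin.sum_univ_two, sumCoeff, diffCoeff]
    simp
    fun_prop
  have key : ∀ {f : (ℝ × ℝ) × ℝ → ℝ}, Continuous f → f x ≠ κ →
      ∀ᶠ y in 𝓝 x, (f y ≤ κ ↔ f x ≤ κ) := by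
    intro f hf hne
    rcases lt_or_gt_of_ne hne with h | h
    · filter_upwards [hf.continuousAt.eventually_lt continuousAt_const h] with y hy
      exact ⟨fun _ => h.le, fun _ => hy.le⟩
    · filter_upwards [continuousAt_const.eventually_lt hf.continuousAt h] with y hy
      exact ⟨fun h' => absurd h' (not_le.2 hy), fun h' => absurd h' (not_le.2 h)⟩
  filter_upwards [n1 (κ - (1 - 2 * x.1.1) * x.2), n1 (-κ - (1 - 2 * x.1.1) * x.2),
    n2 (κ - (1 - 2 * x.1.1) * x.2), n2 (-κ - (1 - 2 * x.1.1) * x.2)] with g g1 g2 g3 g4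
  have k1 := key (c1 g) (fun h => by
    rcases eq_or_eq_neg_of_abs_eq h with h | h
    · exact g1 (by linarith)
    · exact g2 (by linarith))
  have k2 := key (c2 g) (fun h => by
    rcases eq_or_eq_neg_of_abs_eq h with h | h
    · exact g3 (by linarith)
    · exact g4 (by linarith))
  filter_upwards [k1, k2] with y y1 y2
  exact and_congr y1 y2

lemma continuousOn_log_flipProb {κ : ℝ} (hκ : 0 < κ) :
    ContinuousOn (fun x : (ℝ × ℝ) × ℝ => Real.log (flipProb κ x.1 x.2))
      (admissible ×ˢ Set.univ) :=
  (continuousOn_flipProb κ).log fun x hx => (flipProb_pos hκ hx.1 x.2).ne'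

/-! ### Factorial bounds and the entropy of pair counts -/

lemma mul_log_sub_le_log_factorial (n : ℕ) : n * Real.log n - n ≤ Real.log (n.factorial) := by
  rcases Nat.eq_zero_or_pos n with rfl | hn
  · simp
  have hn' : (0 : ℝ) < n := by exact_mod_cast hn
  have hf : (0 : ℝ) < n.factorial := by exact_mod_cast n.factorial_pos
  have h := Real.log_le_log (by positivity) (Real.pow_div_factorial_le_exp (n : ℝ) hn'.le n)
  rw [Real.log_exp, Real.log_div (by positivity) hf.ne', Real.log_pow] at h
  linarith

lemma log_factorial_le_succ_mul_log (n : ℕ) :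
    Real.log (n.factorial) ≤ (n + 1) * Real.log (n + 1) - n := by
  induction n with
  | zero => simp
  | succ n ih =>
    have h1 : (0 : ℝ) < n + 1 := by positivity
    have h2 : (0 : ℝ) < n + 2 := by positivity
    rw [Nat.factorial_succ, Nat.cast_mul, Real.log_mul (by positivity) (by positivity)]
    push_cast
    have h := Real.one_sub_inv_le_log_of_pos (div_pos h2 h1)
    rw [Real.log_div h2.ne' h1.ne', inv_div] at h
    have e : (1 : ℝ) - (n + 1) / (n + 2) = 1 / (n + 2) := by field_simp; ring
    rw [e, div_le_iff₀ h2] at h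
    have e2 : (n : ℝ) + 1 + 1 = n + 2 := by ring
    rw [e2]
    nlinarith

lemma log_factorial_le (n : ℕ) :
    Real.log (n.factorial) ≤ n * Real.log n - n + (Real.log (n + 1) + 1) := by
  rcases Nat.eq_zero_or_pos n with rfl | hn
  · simp
  have hn' : (0 : ℝ) < n := by exact_mod_cast hn
  have h := log_factorial_le_succ_mul_log n
  have h2 := Real.log_le_sub_one_of_pos (div_pos (by positivity : (0 : ℝ) < n + 1) hn')
  rw [Real.log_div (by positivity) hn'.ne'] at h2
  have e : ((n : ℝ) + 1) / n - 1 = 1 / n := by field_simp; ring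
  rw [e, le_div_iff₀ hn'] at h2
  nlinarith

lemma mul_negMulLog_div {N : ℕ} (hN : 0 < N) (n : ℕ) :
    N * Real.negMulLog ((n : ℝ) / N) = n * Real.log N - n * Real.log n := by
  have hN' : (0 : ℝ) < N := by exact_mod_cast hN
  rcases Nat.eq_zero_or_pos n with rfl | hn
  · simp
  have hn' : (0 : ℝ) < n := by exact_mod_cast hn
  rw [Real.negMulLog, Real.log_div hn'.ne' hN'.ne']
  field_simp
  ring

/-- The number of pairs of `d`-subsets of an `N`-set with intersection of size `k`. -/
def pairCount (N d k : ℕ) : ℕ := N.choose d * d.choose k * (N - d).choose (d - k)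

/-- The Shannon entropy of the probability vector `(t, ρ - t, ρ - t, 1 - 2 ρ + t)`. -/
def pairEntropy (p : ℝ × ℝ) : ℝ :=
  Real.negMulLog p.2 + 2 * Real.negMulLog (p.1 - p.2) + Real.negMulLog (1 - 2 * p.1 + p.2)

lemma continuous_pairEntropy : Continuous pairEntropy := by
  unfold pairEntropy
  have := Real.continuous_negMulLog
  fun_prop

lemma pairCount_mul_factorial {N d k : ℕ} (hd : d ≤ N) (hk : k ≤ d) (hdk : 2 * d ≤ N + k) :
    pairCount N d k * (k.factorial * (d - k).factorial * (d - k).factorial *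
      (N + k - 2 * d).factorial) = N.factorial := by
  have h1 := Nat.choose_mul_factorial_mul_factorial hd
  have h2 := Nat.choose_mul_factorial_mul_factorial hk
  have h3 := Nat.choose_mul_factorial_mul_factorial (show d - k ≤ N - d by omega)
  have e : N - d - (d - k) = N + k - 2 * d := by omega
  rw [e] at h3
  rw [← h1, ← h2, ← h3, pairCount]
  ring

lemma pairCount_pos {N d k : ℕ} (hd : d ≤ N) (hk : k ≤ d) (hdk : 2 * d ≤ N + k) :
    0 < pairCount N d k := by
  have := pairCount_mul_factorial hd hk hdk
  exact Nat.pos_of_mul_pos_right (this ▸ N.factorial_pos)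

/-- The error term in the entropy estimate. -/
def entropyError (N : ℕ) : ℝ := 4 * (Real.log (N + 1) + 1) / N

/-- `pairCount` is a multinomial coefficient. Each factorial obeys `log n! = n log n - n` up to an
error in `[0, log (N + 1) + 1]`; the factor 4 in `entropyError` counts the four factorials in the
denominator, whose errors all push the same way. -/
lemma abs_log_pairCount_sub_le {N d k : ℕ} (hN : 0 < N) (hd : d ≤ N) (hk : k ≤ d)
    (hdk : 2 * d ≤ N + k) :
    |1 / (N : ℝ) * Real.log (pairCount N d k) - pairEntropy ((d : ℝ) / N, (k : ℝ) / N)| ≤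
      entropyError N := by
  have hN' : (0 : ℝ) < N := by exact_mod_cast hN
  have hc : (0 : ℝ) < pairCount N d k := by exact_mod_cast pairCount_pos hd hk hdk
  have hf : ∀ n : ℕ, (0 : ℝ) < n.factorial := fun n => by exact_mod_cast n.factorial_pos
  have hlog : Real.log (pairCount N d k) = Real.log N.factorial - Real.log k.factorial -
      2 * Real.log (d - k).factorial - Real.log (N + k - 2 * d).factorial := by
    rw [← pairCount_mul_factorial hd hk hdk]
    push_cast
    rw [Real.log_mul hc.ne' (by have := hf; positivity), Real.log_mul (by positivity) (hf _).ne',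
      Real.log_mul (by positivity) (hf _).ne', Real.log_mul (hf _).ne' (hf _).ne']
    ring
  have mono : ∀ n : ℕ, n ≤ N → Real.log ((n : ℝ) + 1) + 1 ≤ Real.log ((N : ℝ) + 1) + 1 := by
    intro n hn
    have : (n : ℝ) ≤ N := by exact_mod_cast hn
    gcongr
  have lN := mul_log_sub_le_log_factorial N
  have uN := log_factorial_le N
  have l1 := mul_log_sub_le_log_factorial k
  have u1 := (log_factorial_le k).trans (add_le_add_right (mono k (hk.trans hd)) _)
  have l2 := mul_log_sub_le_log_factorial (d - k)
  have u2 := (log_factorial_le (d - k)).trans (add_le_add_right (mono _ (by omega)) _)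
  have l3 := mul_log_sub_le_log_factorial (N + k - 2 * d)
  have u3 := (log_factorial_le (N + k - 2 * d)).trans (add_le_add_right (mono _ (by omega)) _)
  have c1 : ((d - k : ℕ) : ℝ) = d - k := by push_cast [hk]; ring
  have c2 : ((N + k - 2 * d : ℕ) : ℝ) = N + k - 2 * d := by push_cast [hdk]; ring
  have e1 := mul_negMulLog_div hN k
  have e2 := mul_negMulLog_div hN (d - k)
  have e3 := mul_negMulLog_div hN (N + k - 2 * d)
  have a2 : ((d - k : ℕ) : ℝ) / N = d / N - k / N := by rw [c1]; ring
  have a3 : ((N + k - 2 * d : ℕ) : ℝ) / N = 1 - 2 * (d / N) + k / N := by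
    rw [c2]; field_simp; ring
  rw [a2] at e2
  rw [a3] at e3
  have hH : N * pairEntropy ((d : ℝ) / N, (k : ℝ) / N) =
      N * Real.log N - k * Real.log k - 2 * ((d - k : ℕ) * Real.log (d - k : ℕ)) -
        (N + k - 2 * d : ℕ) * Real.log (N + k - 2 * d : ℕ) := by
    have : N * pairEntropy ((d : ℝ) / N, (k : ℝ) / N) =
      N * Real.negMulLog (k / N) + 2 * (N * Real.negMulLog (d / N - k / N)) +
        N * Real.negMulLog (1 - 2 * (d / N) + k / N) := by
      simp only [pairEntropy]; ring
    rw [this, e1, e2, e3]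
    -- The four parts of the multinomial add up to `N`, which collects the `log N` terms.
    have : (k : ℝ) + 2 * (d - k : ℕ) + (N + k - 2 * d : ℕ) = N := by rw [c1, c2]; ring
    linear_combination Real.log N * this
  have hnn : 0 ≤ Real.log ((N : ℝ) + 1) := Real.log_nonneg (by linarith)
  have main : |Real.log (pairCount N d k) - N * pairEntropy ((d : ℝ) / N, (k : ℝ) / N)| ≤
      4 * (Real.log (N + 1) + 1) := by
    rw [hH, hlog, abs_le]
    constructor <;> linarith
  have e : 1 / (N : ℝ) * Real.log (pairCount N d k) - pairEntropy ((d : ℝ) / N, (k : ℝ) / N) =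
      (Real.log (pairCount N d k) - N * pairEntropy ((d : ℝ) / N, (k : ℝ) / N)) / N := by
    field_simp
  rw [e, abs_div, abs_of_pos hN', entropyError]
  gcongr

lemma tendsto_log_succ_div : Tendsto (fun N : ℕ => Real.log ((N : ℝ) + 1) / N) atTop (𝓝 0) := by
  have h1 : Tendsto (fun x : ℝ => Real.log x / x) atTop (𝓝 0) :=
    Real.isLittleO_log_id_atTop.tendsto_div_nhds_zero
  have h2 : Tendsto (fun N : ℕ => ((N : ℝ) + 1)) atTop atTop :=
    tendsto_atTop_add_const_right _ _ tendsto_natCast_atTop_atTop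
  have h3 := (h1.comp h2).mul (tendsto_const_nhds (x := (1 : ℝ)).add
    (tendsto_one_div_atTop_nhds_zero_nat (𝕜 := ℝ)))
  simp only [zero_mul] at h3
  refine h3.congr' ?_
  filter_upwards [eventually_gt_atTop 0] with N hN
  have : (0 : ℝ) < N := by exact_mod_cast hN
  simp only [Function.comp]
  field_simp

lemma tendsto_entropyError : Tendsto entropyError atTop (𝓝 0) := by
  have h := (tendsto_log_succ_div.add (tendsto_one_div_atTop_nhds_zero_nat (𝕜 := ℝ))).const_mul 4
  simp only [add_zero, mul_zero] at h
  refine h.congr fun N => ?_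
  rw [entropyError]
  ring

/-! ### Truncated Gaussians and a uniform law of large numbers -/

lemma isProbabilityMeasure_truncGaussian {κ₀ : ℝ} (hκ₀ : 0 < κ₀) :
    IsProbabilityMeasure (truncGaussian κ₀) := by
  have : (gaussianReal 0 1).IsOpenPosMeasure :=
    (gaussianReal_absolutelyContinuous' 0 one_ne_zero).isOpenPosMeasure
  refine cond_isProbabilityMeasure (ne_of_gt ?_)
  have ho : IsOpen {z : ℝ | |z| < κ₀} := isOpen_lt continuous_abs continuous_const
  refine (ho.measure_pos (gaussianReal 0 1) ⟨0, by simpa using hκ₀⟩).trans_le (measure_mono ?_)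
  exact fun z (hz : |z| < κ₀) => hz.le

lemma ae_truncGaussian_mem_Icc (κ₀ : ℝ) : ∀ᵐ z ∂(truncGaussian κ₀), z ∈ Set.Icc (-κ₀) κ₀ := by
  have h : ∀ᵐ z ∂((gaussianReal 0 1)[|{z : ℝ | |z| ≤ κ₀}]), z ∈ {z : ℝ | |z| ≤ κ₀} :=
    ae_cond_mem (measurableSet_le (by fun_prop) measurable_const)
  exact h.mono fun z hz => abs_le.1 hz

section LawOfLargeNumbers

variable {μ : Measure ℝ} [IsProbabilityMeasure μ]

/-- Hoeffding's inequality for a product measure. -/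
lemma pi_real_sum_sub_integral_ge_le {f : ℝ → ℝ} (hf : Measurable f) {C : ℝ}
    (hC : ∀ᵐ z ∂μ, |f z| ≤ C) {n : ℕ} {ε B : ℝ} (hε : 0 < ε) (hnB : n * C ^ 2 ≤ B)
    (hCpos : 0 < C) :
    (Measure.pi fun _ : Fin n => μ).real {z | ε ≤ ∑ i, (f (z i) - ∫ y, f y ∂μ)} ≤
      Real.exp (-ε ^ 2 / (2 * B)) := by
  -- For `n = 0` the bound `B` may vanish, so the final comparison of exponents is unavailable; but
  -- then the sum is empty and `ε > 0` excludes the event.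
  rcases Nat.eq_zero_or_pos n with rfl | hn
  · have : {z : Fin 0 → ℝ | ε ≤ ∑ i, (f (z i) - ∫ y, f y ∂μ)} = ∅ := by
      ext z
      simpa using hε
    rw [this]
    simpa using Real.exp_nonneg _
  have hsub : HasSubgaussianMGF (fun y => f y - ∫ y, f y ∂μ) ((‖C - -C‖₊ / 2) ^ 2) μ :=
    hasSubgaussianMGF_of_mem_Icc hf.aemeasurable (hC.mono fun z hz => abs_le.1 hz)
  have hsub' : ∀ i : Fin n, HasSubgaussianMGF (fun z : Fin n → ℝ => f (z i) - ∫ y, f y ∂μ)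
      ((‖C - -C‖₊ / 2) ^ 2) (Measure.pi fun _ : Fin n => μ) := by
    intro i
    have hmp := measurePreserving_eval (fun _ : Fin n => μ) i
    -- The mean is frozen first, so that rewriting `μ` as an image measure leaves it alone.
    generalize (∫ y, f y ∂μ) = c at hsub ⊢
    rw [← hmp.map_eq] at hsub
    exact HasSubgaussianMGF.of_map hmp.measurable.aemeasurable hsub
  have hind : iIndepFun (fun (i : Fin n) (z : Fin n → ℝ) => f (z i) - ∫ y, f y ∂μ)
      (Measure.pi fun _ : Fin n => μ) :=
    iIndepFun_pi (X := fun _ y => f y - ∫ y, f y ∂μ) fun _ => by fun_prop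
  have h := HasSubgaussianMGF.measure_sum_ge_le_of_iIndepFun hind (s := Finset.univ)
    (fun i _ => hsub' i) hε.le
  refine h.trans (Real.exp_le_exp.2 ?_)
  have e : (‖C - -C‖ / 2) ^ 2 = C ^ 2 := by
    simp only [Real.norm_eq_abs, div_pow, sq_abs]
    ring
  simp only [Finset.sum_const, Finset.card_univ, Fintype.card_fin, nsmul_eq_mul]
  push_cast
  rw [e, neg_div, neg_div]
  have hn' : (0 : ℝ) < n := by exact_mod_cast hn
  have : 0 < (n : ℝ) * C ^ 2 := by positivity
  exact neg_le_neg (by gcongr)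

lemma pi_real_abs_sum_sub_integral_ge_le {f : ℝ → ℝ} (hf : Measurable f) {C : ℝ}
    (hC : ∀ᵐ z ∂μ, |f z| ≤ C) {n : ℕ} {ε B : ℝ} (hε : 0 < ε) (hnB : n * C ^ 2 ≤ B)
    (hCpos : 0 < C) :
    (Measure.pi fun _ : Fin n => μ).real {z | ε ≤ |∑ i, (f (z i) - ∫ y, f y ∂μ)|} ≤
      2 * Real.exp (-ε ^ 2 / (2 * B)) := by
  have h1 := pi_real_sum_sub_integral_ge_le hf hC hε hnB hCpos
  have h2 := pi_real_sum_sub_integral_ge_le (f := fun z => -f z) hf.neg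
    (hC.mono fun z hz => by simpa using hz) hε hnB hCpos
  rw [two_mul]
  refine (measureReal_mono ?_).trans ((measureReal_union_le _ _).trans (add_le_add h1 h2))
  intro z hz
  rcases le_abs'.1 (Set.mem_ofPred_eq ▸ hz) with h | h
  · right
    simp only [Set.mem_ofPred_eq, integral_neg, ← neg_sub', Finset.sum_neg_distrib]
    linarith
  · exact Or.inl h

variable {Ω : Type*} [MeasurableSpace Ω] {P : Measure Ω} [IsProbabilityMeasure P] {α : ℝ}
  {w : (N : ℕ) → Ω → Fin ⌊α * (N : ℝ)⌋₊ → ℝ}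

/-- Strong law of large numbers for a triangular array with independent rows. -/
lemma ae_tendsto_row_average (hα : 0 < α) (hw : ∀ N, Measurable (w N))
    (hlaw : ∀ N, P.map (w N) = Measure.pi fun _ => μ) {f : ℝ → ℝ} (hf : Measurable f) {C : ℝ}
    (hC : ∀ᵐ z ∂μ, |f z| ≤ C) {ε : ℝ} (hε : 0 < ε) :
    ∀ᵐ ω ∂P, ∀ᶠ N : ℕ in atTop,
      |1 / (N : ℝ) * ∑ a, f (w N ω a) - α * ∫ y, f y ∂μ| ≤ ε := by
  wlog hCpos : 0 < C generalizing C
  · exact this (hC.mono fun z hz => hz.trans (le_max_left C 1))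
      (lt_of_lt_of_le one_pos (le_max_right C 1))
  set s : ℕ → Set Ω := fun N =>
    {ω | ε / 2 * N ≤ |∑ a, (f (w N ω a) - ∫ y, f y ∂μ)|} ∩ {_ω | 0 < N} with hs
  have hbound : ∀ N, P (s N) ≤
      ENNReal.ofReal (2 * Real.exp (N * -((ε / 2) ^ 2 / (2 * (α * C ^ 2))))) := by
    intro N
    rcases Nat.eq_zero_or_pos N with rfl | hN
    · simp [hs]
    have hN' : (0 : ℝ) < N := by exact_mod_cast hN
    have h := pi_real_abs_sum_sub_integral_ge_le hf hC (n := ⌊α * (N : ℝ)⌋₊)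
      (ε := ε / 2 * N) (B := α * N * C ^ 2) (by positivity)
      (by have := Nat.floor_le (show 0 ≤ α * (N : ℝ) by positivity); gcongr) hCpos
    rw [← hlaw N, map_measureReal_apply (hw N)
      (measurableSet_le measurable_const (by fun_prop))] at h
    have e : -(ε / 2 * N) ^ 2 / (2 * (α * N * C ^ 2)) =
        N * -((ε / 2) ^ 2 / (2 * (α * C ^ 2))) := by
      field_simp
    rw [e] at h
    rw [← ofReal_measureReal]
    refine ENNReal.ofReal_le_ofReal (le_trans (measureReal_mono ?_) h)
    exact fun ω hω => hω.1
  have hsum : Summable fun N : ℕ =>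
      2 * Real.exp (N * -((ε / 2) ^ 2 / (2 * (α * C ^ 2)))) := by
    refine Summable.mul_left 2 (Real.summable_exp_nat_mul_iff.2 ?_)
    have : 0 < (ε / 2) ^ 2 / (2 * (α * C ^ 2)) := by positivity
    linarith
  -- Summability alone suffices for the first Borel–Cantelli lemma; no independence between rows is
  -- needed.
  have hne : ∑' N, P (s N) ≠ ⊤ :=
    ne_top_of_le_ne_top hsum.tsum_ofReal_ne_top (ENNReal.tsum_le_tsum hbound)
  -- The row has `⌊αN⌋` entries instead of `αN`; this is the resulting bias.
  have hfl : Tendsto (fun N : ℕ => ((⌊α * (N : ℝ)⌋₊ : ℝ) / N - α) * ∫ y, f y ∂μ) atTop (𝓝 0) := by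
    have h1 := (tendsto_nat_floor_mul_div_atTop hα.le).comp (tendsto_natCast_atTop_atTop (R := ℝ))
    simpa using (h1.sub_const α).mul_const (∫ y, f y ∂μ)
  filter_upwards [ae_eventually_notMem hne] with ω hω
  filter_upwards [hω, eventually_gt_atTop 0,
    (Metric.tendsto_nhds.1 hfl) (ε / 2) (by positivity)] with N h1 hN h2
  have hN' : (0 : ℝ) < N := by exact_mod_cast hN
  have h3 : |∑ a, (f (w N ω a) - ∫ y, f y ∂μ)| < ε / 2 * N := by
    by_contra h
    exact h1 ⟨not_lt.1 h, hN⟩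
  rw [dist_zero_right, Real.norm_eq_abs] at h2
  have e : 1 / (N : ℝ) * ∑ a, f (w N ω a) - α * ∫ y, f y ∂μ =
      (∑ a, (f (w N ω a) - ∫ y, f y ∂μ)) / N +
        ((⌊α * (N : ℝ)⌋₊ : ℝ) / N - α) * ∫ y, f y ∂μ := by
    rw [Finset.sum_sub_distrib]
    simp
    field_simp
    ring
  rw [e]
  have h4 : |(∑ a, (f (w N ω a) - ∫ y, f y ∂μ)) / N| ≤ ε / 2 := by
    rw [abs_div, abs_of_pos hN', div_le_iff₀ hN']
    exact h3.le
  linarith [abs_add_le ((∑ a, (f (w N ω a) - ∫ y, f y ∂μ)) / N)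
    (((⌊α * (N : ℝ)⌋₊ : ℝ) / N - α) * ∫ y, f y ∂μ)]

/-- Strong law of large numbers for a triangular array with independent rows, uniformly over a
compact family of functions. -/
lemma ae_uniform_row_average {E : Type*} [MetricSpace E] (hα : 0 < α)
    (hw : ∀ N, Measurable (w N)) (hlaw : ∀ N, P.map (w N) = Measure.pi fun _ => μ)
    {κ₀ : ℝ} (hμ : ∀ᵐ z ∂μ, z ∈ Set.Icc (-κ₀) κ₀) {X : Set E} (hX : IsCompact X)
    {F : E × ℝ → ℝ} (hF : ContinuousOn F (X ×ˢ Set.univ)) {ε : ℝ} (hε : 0 < ε) :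
    ∀ᵐ ω ∂P, ∀ᶠ N : ℕ in atTop, ∀ x ∈ X,
      |1 / (N : ℝ) * ∑ a, F (x, w N ω a) - α * ∫ y, F (x, y) ∂μ| ≤ ε := by
  have hK : IsCompact (X ×ˢ Set.Icc (-κ₀) κ₀) := hX.prod isCompact_Icc
  have hFK : ContinuousOn F (X ×ˢ Set.Icc (-κ₀) κ₀) :=
    hF.mono (Set.prod_mono_right (Set.subset_univ _))
  have hFx : ∀ x ∈ X, Continuous fun z => F (x, z) := fun x hx =>
    hF.comp_continuous (by fun_prop) fun z => ⟨hx, Set.mem_univ _⟩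
  obtain ⟨C, hC⟩ := hK.exists_bound_of_continuousOn hFK
  have hCx : ∀ x ∈ X, ∀ᵐ z ∂μ, |F (x, z)| ≤ C := fun x hx =>
    hμ.mono fun z hz => hC (x, z) ⟨hx, hz⟩
  have hint : ∀ x ∈ X, Integrable (fun z => F (x, z)) μ := fun x hx =>
    Integrable.of_bound (hFx x hx).measurable.aestronglyMeasurable C (hCx x hx)
  -- Moving from `x` to a net point costs `αη` in the sum and `αη` in the integral; the net point
  -- itself costs `η`.
  set η : ℝ := ε / (2 * α + 1) with hη
  have hηpos : 0 < η := by positivity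
  obtain ⟨δ, hδ, hUC⟩ :=
    Metric.uniformContinuousOn_iff.1 (hK.uniformContinuousOn_of_continuous hFK) η hηpos
  obtain ⟨T, hTX, hTfin, hT⟩ := hX.finite_cover_balls hδ
  have hmem : ∀ᵐ ω ∂P, ∀ N a, w N ω a ∈ Set.Icc (-κ₀) κ₀ := by
    rw [ae_all_iff]
    intro N
    rw [ae_all_iff]
    intro a
    have h1 : ∀ᵐ z ∂(Measure.pi fun _ : Fin ⌊α * (N : ℝ)⌋₊ => μ), z a ∈ Set.Icc (-κ₀) κ₀ :=
      (measurePreserving_eval (fun _ : Fin ⌊α * (N : ℝ)⌋₊ => μ) a).quasiMeasurePreserving.ae hμ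
    rw [← hlaw N] at h1
    exact ae_of_ae_map (hw N).aemeasurable h1
  have hpt : ∀ᵐ ω ∂P, ∀ t ∈ T, ∀ᶠ N : ℕ in atTop,
      |1 / (N : ℝ) * ∑ a, F (t, w N ω a) - α * ∫ y, F (t, y) ∂μ| ≤ η := by
    rw [ae_ball_iff hTfin.countable]
    intro t ht
    exact ae_tendsto_row_average hα hw hlaw (hFx t (hTX ht)).measurable (hCx t (hTX ht)) hηpos
  filter_upwards [hmem, hpt] with ω h1 h2
  filter_upwards [(eventually_all_finite hTfin).2 h2, eventually_gt_atTop 0] with N h3 hN x hx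
  have hN' : (0 : ℝ) < N := by exact_mod_cast hN
  obtain ⟨t, ht, hxt⟩ := Set.mem_iUnion₂.1 (hT hx)
  have hclose : ∀ z ∈ Set.Icc (-κ₀) κ₀, |F (x, z) - F (t, z)| ≤ η := by
    intro z hz
    have := hUC (x, z) ⟨hx, hz⟩ (t, z) ⟨hTX ht, hz⟩ (by
      rw [Prod.dist_eq]; simpa [hδ] using hxt)
    rw [Real.dist_eq] at this
    exact this.le
  have hsum : |1 / (N : ℝ) * ∑ a, F (x, w N ω a) - 1 / (N : ℝ) * ∑ a, F (t, w N ω a)| ≤ α * η := by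
    rw [← mul_sub, ← Finset.sum_sub_distrib, abs_mul, abs_of_pos (by positivity),
      one_div, inv_mul_le_iff₀ hN']
    calc |∑ a, (F (x, w N ω a) - F (t, w N ω a))|
        ≤ ∑ a, |F (x, w N ω a) - F (t, w N ω a)| := Finset.abs_sum_le_sum_abs _ _
      _ ≤ ∑ _a : Fin ⌊α * (N : ℝ)⌋₊, η := Finset.sum_le_sum fun a _ => hclose _ (h1 N a)
      _ = ⌊α * (N : ℝ)⌋₊ * η := by simp
      _ ≤ α * N * η := by
        have := Nat.floor_le (show 0 ≤ α * (N : ℝ) by positivity)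
        gcongr
      _ = N * (α * η) := by ring
  have hintd : |α * ∫ y, F (x, y) ∂μ - α * ∫ y, F (t, y) ∂μ| ≤ α * η := by
    rw [← mul_sub, ← integral_sub (hint x hx) (hint t (hTX ht)), abs_mul, abs_of_pos hα]
    gcongr
    have := norm_integral_le_of_norm_le_const (μ := μ) (f := fun y => F (x, y) - F (t, y))
      (C := η) (hμ.mono fun z hz => hclose z hz)
    simpa using this
  have e : η * (2 * α + 1) = ε := by rw [hη]; field_simp
  have h4 := h3 t ht
  rw [abs_le] at *
  constructor <;> nlinarith [hsum.1, hsum.2, hintd.1, hintd.2, h4.1, h4.2]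

end LawOfLargeNumbers

/-! ### The rate function -/

/-- The exponential growth rate of the expected number of pairs of solutions at distance `ρ` from
the planted solution, with overlap `t` of the flipped sets. -/
def pairRate (α κ₀ κ : ℝ) (p : ℝ × ℝ) : ℝ :=
  pairEntropy p + α * ∫ z, Real.log (flipProb κ p z) ∂(truncGaussian κ₀)

/-- A compact part of `admissible`. -/
def admissibleCore (δ : ℝ) : Set (ℝ × ℝ) := {p | p ∈ admissible ∧ δ ≤ p.1 ∧ p.1 ≤ 1 - δ}

lemma admissibleCore_subset (δ : ℝ) : admissibleCore δ ⊆ admissible := fun _ hp => hp.1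

lemma isCompact_admissibleCore {δ : ℝ} (hδ : 0 < δ) : IsCompact (admissibleCore δ) := by
  have hsub : admissibleCore δ ⊆ Set.Icc 0 1 ×ˢ Set.Icc 0 1 := by
    rintro p ⟨⟨h0, h1, h2, h3, h4⟩, h5, h6⟩
    exact ⟨⟨h0.le, h1.le⟩, h2, h3.trans h1.le⟩
  have heq : admissibleCore δ =
      {p : ℝ × ℝ | δ ≤ p.1} ∩ ({p | p.1 ≤ 1 - δ} ∩ ({p | 0 ≤ p.2} ∩ ({p | p.2 ≤ p.1} ∩
        {p | 2 * p.1 - 1 ≤ p.2}))) := by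
    ext p
    simp only [admissibleCore, admissible, Set.mem_ofPred_eq, Set.mem_inter_iff]
    constructor
    · rintro ⟨⟨h0, h1, h2, h3, h4⟩, h5, h6⟩
      exact ⟨h5, h6, h2, h3, h4⟩
    · rintro ⟨h5, h6, h2, h3, h4⟩
      exact ⟨⟨by linarith, by linarith, h2, h3, h4⟩, h5, h6⟩
  refine (isCompact_Icc.prod isCompact_Icc).of_isClosed_subset ?_ hsub
  rw [heq]
  exact (isClosed_le (by fun_prop) (by fun_prop)).inter <|
    (isClosed_le (by fun_prop) (by fun_prop)).inter <|
    (isClosed_le (by fun_prop) (by fun_prop)).inter <|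
    (isClosed_le (by fun_prop) (by fun_prop)).inter <|
    isClosed_le (by fun_prop) (by fun_prop)

lemma continuousOn_pairRate {κ₀ κ : ℝ} (hκ₀ : 0 < κ₀) (hκ : 0 < κ) (α : ℝ) {δ : ℝ} (hδ : 0 < δ) :
    ContinuousOn (pairRate α κ₀ κ) (admissibleCore δ) := by
  have := isProbabilityMeasure_truncGaussian hκ₀
  have hF := (continuousOn_log_flipProb hκ).mono
    (Set.prod_mono_left (t := Set.univ) (admissibleCore_subset δ))
  obtain ⟨C, hC⟩ := ((isCompact_admissibleCore hδ).prod
    (isCompact_Icc (a := -κ₀) (b := κ₀))).exists_bound_of_continuousOn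
    (hF.mono (Set.prod_mono_right (Set.subset_univ _)))
  refine continuous_pairEntropy.continuousOn.add (continuousOn_const.mul ?_)
  refine continuousOn_of_dominated (bound := fun _ => C) ?_ ?_ (integrable_const _) ?_
  · intro p hp
    exact (hF.comp_continuous (f := fun z => (p, z)) (by fun_prop)
      fun z => ⟨hp, Set.mem_univ _⟩).aestronglyMeasurable
  · intro p hp
    exact (ae_truncGaussian_mem_Icc κ₀).mono fun z hz => hC (p, z) ⟨hp, hz⟩
  · exact ae_of_all _ fun z => hF.comp (f := fun p => (p, z)) (by fun_prop)
      fun p hp => ⟨hp, Set.mem_univ _⟩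

lemma exists_margin {ρ : ℝ} (h0 : 0 < ρ) (h1 : ρ < 1) : ∃ δ, 0 < δ ∧ δ < ρ ∧ ρ < 1 - δ :=
  ⟨min ρ (1 - ρ) / 2, by have := lt_min h0 (sub_pos.2 h1); linarith,
    by have := min_le_left ρ (1 - ρ); linarith, by have := min_le_right ρ (1 - ρ); linarith⟩

/-- Upper semicontinuity of `r ↦ max_t pairRate (r, t)`: the radii `r` in `[δ, 1 - δ]` with a value
at least `L + ε` form the projection of a compact set, which is closed and misses `ρ`. It is needed
because `d/N` only tends to `ρ`. -/
lemma eventually_pairRate_le {κ₀ κ : ℝ} (hκ₀ : 0 < κ₀) (hκ : 0 < κ) (α : ℝ) {ρ L ε : ℝ}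
    (h0 : 0 < ρ) (h1 : ρ < 1) (hL : ∀ t, (ρ, t) ∈ admissible → pairRate α κ₀ κ (ρ, t) ≤ L)
    (hε : 0 < ε) :
    ∀ᶠ r in 𝓝 ρ, ∀ t, (r, t) ∈ admissible → pairRate α κ₀ κ (r, t) ≤ L + ε := by
  obtain ⟨δ, hδ, hδ0, hδ1⟩ := exists_margin h0 h1
  have hX := isCompact_admissibleCore hδ
  have hB : IsClosed (Prod.fst '' (admissibleCore δ ∩ pairRate α κ₀ κ ⁻¹' Set.Ici (L + ε))) := by
    refine IsCompact.isClosed (IsCompact.image ?_ continuous_fst)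
    exact hX.of_isClosed_subset ((continuousOn_pairRate hκ₀ hκ α hδ).preimage_isClosed_of_isClosed
      hX.isClosed isClosed_Ici) Set.inter_subset_left
  have hρ : ρ ∈ (Prod.fst '' (admissibleCore δ ∩ pairRate α κ₀ κ ⁻¹' Set.Ici (L + ε)))ᶜ := by
    rintro ⟨⟨r, t⟩, ⟨hr1, hr2⟩, rfl⟩
    have := hL t hr1.1
    have h3 : L + ε ≤ pairRate α κ₀ κ (r, t) := hr2
    linarith
  filter_upwards [hB.isOpen_compl.mem_nhds hρ, lt_mem_nhds hδ0, gt_mem_nhds hδ1] with r hr a b t ht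
  by_contra hcon
  exact hr ⟨(r, t), ⟨⟨ht, a.le, b.le⟩, (not_le.1 hcon).le⟩, rfl⟩

/-! ### Discrete overlaps and Laplace's method -/

/-- The possible overlaps of two `d`-subsets of an `N`-set. -/
def overlaps (N d : ℕ) : Finset ℕ := (Finset.range (d + 1)).filter fun k => 2 * d ≤ N + k

lemma mem_overlaps {N d k : ℕ} : k ∈ overlaps N d ↔ k ≤ d ∧ 2 * d ≤ N + k := by
  simp [overlaps]

lemma self_mem_overlaps {N d : ℕ} (hd : d ≤ N) : d ∈ overlaps N d :=
  mem_overlaps.2 ⟨le_rfl, by omega⟩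

lemma overlap_mem_admissible {N d k : ℕ} (hd0 : 0 < d) (hdN : d < N) (hk : k ∈ overlaps N d) :
    ((d : ℝ) / N, (k : ℝ) / N) ∈ admissible := by
  obtain ⟨h1, h2⟩ := mem_overlaps.1 hk
  have hN : (0 : ℝ) < N := by exact_mod_cast hd0.trans hdN
  have hd0' : (0 : ℝ) < d := by exact_mod_cast hd0
  have hdN' : (d : ℝ) < N := by exact_mod_cast hdN
  have h1' : (k : ℝ) ≤ d := by exact_mod_cast h1
  have h2' : 2 * (d : ℝ) ≤ N + k := by exact_mod_cast h2
  refine ⟨by positivity, ?_, by positivity, by simp only; gcongr, ?_⟩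
  · simpa [div_lt_one hN] using hdN'
  · simp only
    rw [← sub_nonneg]
    have : (k : ℝ) / N - (2 * (d / N) - 1) = (N + k - 2 * d) / N := by field_simp; ring
    rw [this]
    exact div_nonneg (by linarith) hN.le

/-- Every admissible overlap is a limit of discrete overlaps. -/
lemma exists_tendsto_overlap {ρ t : ℝ} (ht : (ρ, t) ∈ admissible) {d : ℕ → ℕ}
    (hd : Tendsto (fun N : ℕ => (d N : ℝ) / N) atTop (𝓝 ρ)) (hdN : ∀ᶠ N in atTop, d N ≤ N) :
    ∃ k : ℕ → ℕ, (∀ᶠ N in atTop, k N ∈ overlaps N (d N)) ∧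
      Tendsto (fun N : ℕ => (k N : ℝ) / N) atTop (𝓝 t) := by
  obtain ⟨h0, h1, h2, h3, h4⟩ := ht
  simp only at h0 h1 h2 h3 h4
  -- `⌊tN⌋` is clamped to the range of possible overlaps. The truncated subtraction already encodes
  -- the bound `k ≥ 0`.
  refine ⟨fun N => max (2 * d N - N) (min (d N) ⌊t * (N : ℝ)⌋₊), ?_, ?_⟩
  · filter_upwards [hdN] with N hN
    rw [mem_overlaps]
    omega
  · have hfl := (tendsto_nat_floor_mul_div_atTop h2).comp (tendsto_natCast_atTop_atTop (R := ℝ))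
    have hlim := (((hd.const_mul 2).sub_const 1).max (tendsto_const_nhds (x := (0 : ℝ)))).max
      (hd.min hfl)
    have e : max (max (2 * ρ - 1) 0) (min ρ t) = t := by
      rw [min_eq_right h3, max_eq_right (max_le h4 h2)]
    rw [e] at hlim
    refine hlim.congr' ?_
    filter_upwards [eventually_gt_atTop 0] with N hN
    have hN' : (0 : ℝ) < N := by exact_mod_cast hN
    have hsub : ((2 * d N - N : ℕ) : ℝ) = max (2 * (d N : ℝ) - N) 0 := by
      rcases le_total N (2 * d N) with h | h
      · have h' : (N : ℝ) ≤ 2 * d N := by exact_mod_cast h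
        rw [max_eq_left (by linarith)]
        push_cast [h]
        ring
      · have h' : 2 * (d N : ℝ) ≤ N := by exact_mod_cast h
        rw [max_eq_right (by linarith), Nat.sub_eq_zero_of_le h]
        simp
    simp only [Function.comp, Nat.cast_max, Nat.cast_min, hsub]
    rw [← max_div_div_right hN'.le, ← max_div_div_right hN'.le, ← min_div_div_right hN'.le]
    congr 2
    · field_simp
    · simp

/-- The exponential growth rate of a sum of at most `N + 1` positive terms is that of its largest
term. -/
lemma tendsto_log_sum {K : ℕ → Finset ℕ} (hK : ∀ᶠ N in atTop, (K N).card ≤ N + 1)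
    {T : ℕ → ℕ → ℝ} (hT : ∀ᶠ N in atTop, ∀ k ∈ K N, 0 < T N k) {L : ℝ}
    (hup : ∀ ε > 0, ∀ᶠ N : ℕ in atTop, ∀ k ∈ K N, 1 / (N : ℝ) * Real.log (T N k) ≤ L + ε)
    (hlow : ∀ ε > 0, ∀ᶠ N : ℕ in atTop, ∃ k ∈ K N, L - ε ≤ 1 / (N : ℝ) * Real.log (T N k)) :
    Tendsto (fun N : ℕ => 1 / (N : ℝ) * Real.log (∑ k ∈ K N, T N k)) atTop (𝓝 L) := by
  rw [Metric.tendsto_nhds]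
  intro ε hε
  -- The number of terms contributes `log (N + 1)/N < ε/2`, which with the `ε/3` from the largest
  -- term stays below `ε`.
  have hlog := Metric.tendsto_nhds.1 tendsto_log_succ_div (ε / 2) (by positivity)
  filter_upwards [hK, hT, hup (ε / 3) (by positivity), hlow (ε / 3) (by positivity), hlog,
    eventually_gt_atTop 0] with N h1 h2 h3 h4 h5 hN
  have hN' : (0 : ℝ) < N := by exact_mod_cast hN
  obtain ⟨k, hk, hkL⟩ := h4
  have hle : T N k ≤ ∑ k ∈ K N, T N k :=
    Finset.single_le_sum (fun j hj => (h2 j hj).le) hk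
  have hpos : 0 < ∑ k ∈ K N, T N k := (h2 k hk).trans_le hle
  have hlo : 1 / (N : ℝ) * Real.log (T N k) ≤ 1 / (N : ℝ) * Real.log (∑ k ∈ K N, T N k) :=
    mul_le_mul_of_nonneg_left (Real.log_le_log (h2 k hk) hle) (by positivity)
  have hsum : ∑ k ∈ K N, T N k ≤ (N + 1) * Real.exp (N * (L + ε / 3)) := by
    calc ∑ k ∈ K N, T N k ≤ ∑ _k ∈ K N, Real.exp (N * (L + ε / 3)) := by
          refine Finset.sum_le_sum fun j hj => ?_
          rw [← Real.log_le_iff_le_exp (h2 j hj)]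
          have := h3 j hj
          rwa [one_div, inv_mul_le_iff₀ hN'] at this
      _ = (K N).card * Real.exp (N * (L + ε / 3)) := by simp
      _ ≤ (N + 1) * Real.exp (N * (L + ε / 3)) := by
          gcongr
          exact_mod_cast h1
  have hhi : 1 / (N : ℝ) * Real.log (∑ k ∈ K N, T N k) ≤
      Real.log (N + 1) / N + (L + ε / 3) := by
    have := Real.log_le_log hpos hsum
    rw [Real.log_mul (by positivity) (Real.exp_pos _).ne', Real.log_exp] at this
    rw [one_div, inv_mul_le_iff₀ hN']
    refine this.trans (le_of_eq ?_)
    field_simp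
  rw [dist_zero_right, Real.norm_eq_abs, abs_lt] at h5
  rw [Real.dist_eq, abs_lt]
  constructor <;> linarith [h5.2]

section Sums

variable {α κ₀ κ ρ : ℝ} {w : (N : ℕ) → Fin ⌊α * (N : ℝ)⌋₊ → ℝ} {d : ℕ → ℕ}

/-- The expected number, given `w`, of pairs of solutions at distance `d` with overlap `k`. -/
def pairTerm {M : ℕ} (κ : ℝ) (w : Fin M → ℝ) (N d k : ℕ) : ℝ :=
  pairCount N d k * ∏ a, flipProb κ ((d : ℝ) / N, (k : ℝ) / N) (w a)

lemma pairTerm_pos {M : ℕ} (hκ : 0 < κ) (w : Fin M → ℝ) {N d k : ℕ} (hd0 : 0 < d) (hdN : d < N)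
    (hk : k ∈ overlaps N d) : 0 < pairTerm κ w N d k := by
  obtain ⟨h1, h2⟩ := mem_overlaps.1 hk
  have := pairCount_pos hdN.le h1 h2
  have hp : 0 < ∏ a, flipProb κ ((d : ℝ) / N, (k : ℝ) / N) (w a) :=
    Finset.prod_pos fun a _ => flipProb_pos hκ (overlap_mem_admissible hd0 hdN hk) _
  unfold pairTerm
  positivity

lemma eventually_pos_and_lt (h0 : 0 < ρ) (h1 : ρ < 1)
    (hd : Tendsto (fun N : ℕ => (d N : ℝ) / N) atTop (𝓝 ρ)) :
    ∀ᶠ N in atTop, 0 < d N ∧ d N < N := by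
  filter_upwards [hd.eventually (lt_mem_nhds h0), hd.eventually (gt_mem_nhds h1),
    eventually_gt_atTop 0] with N a b hN
  have hN' : (0 : ℝ) < N := by exact_mod_cast hN
  rw [div_lt_one hN'] at b
  exact ⟨Nat.pos_of_ne_zero fun h => by simp [h] at a, by exact_mod_cast b⟩

/-- `pairRate` is the exponential growth rate of `pairTerm`, uniformly in the overlap. -/
lemma eventually_abs_log_pairTerm_sub_le (hκ : 0 < κ) (h0 : 0 < ρ) (h1 : ρ < 1)
    (hd : Tendsto (fun N : ℕ => (d N : ℝ) / N) atTop (𝓝 ρ))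
    (hw : ∀ δ > 0, ∀ ε > 0, ∀ᶠ N : ℕ in atTop, ∀ p ∈ admissibleCore δ,
      |1 / (N : ℝ) * ∑ a, Real.log (flipProb κ p (w N a)) -
        α * ∫ z, Real.log (flipProb κ p z) ∂(truncGaussian κ₀)| ≤ ε) {ε : ℝ} (hε : 0 < ε) :
    ∀ᶠ N : ℕ in atTop, ∀ k ∈ overlaps N (d N),
      |1 / (N : ℝ) * Real.log (pairTerm κ (w N) N (d N) k) -
        pairRate α κ₀ κ ((d N : ℝ) / N, (k : ℝ) / N)| ≤ ε := by
  obtain ⟨δ, hδ, hδ0, hδ1⟩ := exists_margin h0 h1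
  filter_upwards [eventually_pos_and_lt h0 h1 hd, hw δ hδ (ε / 2) (by positivity),
    hd.eventually (lt_mem_nhds hδ0), hd.eventually (gt_mem_nhds hδ1),
    Metric.tendsto_nhds.1 tendsto_entropyError (ε / 2) (by positivity)] with N hdN hN a b c k hk
  have hadm := overlap_mem_admissible hdN.1 hdN.2 hk
  obtain ⟨k1, k2⟩ := mem_overlaps.1 hk
  have e1 := hN _ ⟨hadm, a.le, b.le⟩
  have e2 := abs_log_pairCount_sub_le (hdN.1.trans hdN.2) hdN.2.le k1 k2
  have hc : (0 : ℝ) < pairCount N (d N) k := by exact_mod_cast pairCount_pos hdN.2.le k1 k2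
  have hpos := fun a => flipProb_pos hκ hadm (w N a)
  rw [dist_zero_right, Real.norm_eq_abs] at c
  rw [pairTerm, Real.log_mul hc.ne' (Finset.prod_pos fun a _ => hpos a).ne',
    Real.log_prod fun a _ => (hpos a).ne', pairRate, mul_add, add_sub_add_comm]
  refine (abs_add_le _ _).trans ?_
  linarith [le_abs_self (entropyError N)]

/-- If the overlaps converge to `t`, then `pairTerm` has growth rate `pairRate α κ₀ κ (ρ, t)`. -/
lemma tendsto_log_pairTerm (hκ₀ : 0 < κ₀) (hκ : 0 < κ) (h0 : 0 < ρ) (h1 : ρ < 1)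
    (hd : Tendsto (fun N : ℕ => (d N : ℝ) / N) atTop (𝓝 ρ))
    (hw : ∀ δ > 0, ∀ ε > 0, ∀ᶠ N : ℕ in atTop, ∀ p ∈ admissibleCore δ,
      |1 / (N : ℝ) * ∑ a, Real.log (flipProb κ p (w N a)) -
        α * ∫ z, Real.log (flipProb κ p z) ∂(truncGaussian κ₀)| ≤ ε)
    {k : ℕ → ℕ} (hk : ∀ᶠ N in atTop, k N ∈ overlaps N (d N)) {t : ℝ}
    (ht : (ρ, t) ∈ admissible) (hkt : Tendsto (fun N : ℕ => (k N : ℝ) / N) atTop (𝓝 t)) :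
    Tendsto (fun N : ℕ => 1 / (N : ℝ) * Real.log (pairTerm κ (w N) N (d N) (k N))) atTop
      (𝓝 (pairRate α κ₀ κ (ρ, t))) := by
  obtain ⟨δ, hδ, hδ0, hδ1⟩ := exists_margin h0 h1
  have hlim : Tendsto (fun N : ℕ => pairRate α κ₀ κ ((d N : ℝ) / N, (k N : ℝ) / N)) atTop
      (𝓝 (pairRate α κ₀ κ (ρ, t))) := by
    refine (continuousOn_pairRate hκ₀ hκ α hδ (ρ, t) ⟨ht, hδ0.le, hδ1.le⟩).tendsto.comp
      (tendsto_nhdsWithin_iff.2 ⟨hd.prodMk_nhds hkt, ?_⟩)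
    filter_upwards [eventually_pos_and_lt h0 h1 hd, hk, hd.eventually (lt_mem_nhds hδ0),
      hd.eventually (gt_mem_nhds hδ1)] with N hdN hkN a b
    exact ⟨overlap_mem_admissible hdN.1 hdN.2 hkN, a.le, b.le⟩
  have hdiff : Tendsto (fun N : ℕ => 1 / (N : ℝ) * Real.log (pairTerm κ (w N) N (d N) (k N)) -
      pairRate α κ₀ κ ((d N : ℝ) / N, (k N : ℝ) / N)) atTop (𝓝 0) := by
    rw [Metric.tendsto_nhds]
    intro ε hε
    filter_upwards [eventually_abs_log_pairTerm_sub_le hκ h0 h1 hd hw (half_pos hε), hk]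
      with N hN hkN
    rw [dist_zero_right, Real.norm_eq_abs]
    linarith [hN _ hkN]
  simpa using hdiff.add hlim

/-- The sum over all overlaps has growth rate the maximum of `pairRate α κ₀ κ (ρ, ·)`. -/
lemma tendsto_log_sum_pairTerm (hκ₀ : 0 < κ₀) (hκ : 0 < κ) (h0 : 0 < ρ) (h1 : ρ < 1)
    (hd : Tendsto (fun N : ℕ => (d N : ℝ) / N) atTop (𝓝 ρ))
    (hw : ∀ δ > 0, ∀ ε > 0, ∀ᶠ N : ℕ in atTop, ∀ p ∈ admissibleCore δ,
      |1 / (N : ℝ) * ∑ a, Real.log (flipProb κ p (w N a)) -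
        α * ∫ z, Real.log (flipProb κ p z) ∂(truncGaussian κ₀)| ≤ ε)
    {t : ℝ} (ht : (ρ, t) ∈ admissible)
    (hmax : ∀ s, (ρ, s) ∈ admissible → pairRate α κ₀ κ (ρ, s) ≤ pairRate α κ₀ κ (ρ, t)) :
    Tendsto (fun N : ℕ => 1 / (N : ℝ) *
      Real.log (∑ k ∈ overlaps N (d N), pairTerm κ (w N) N (d N) k)) atTop
      (𝓝 (pairRate α κ₀ κ (ρ, t))) := by
  have hdN := eventually_pos_and_lt h0 h1 hd
  refine tendsto_log_sum ?_ ?_ ?_ ?_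
  · filter_upwards [hdN] with N hN
    refine (Finset.card_filter_le _ _).trans ?_
    rw [Finset.card_range]
    omega
  · filter_upwards [hdN] with N hN k hk
    exact pairTerm_pos hκ _ hN.1 hN.2 hk
  · intro ε hε
    filter_upwards [hdN, eventually_abs_log_pairTerm_sub_le hκ h0 h1 hd hw (half_pos hε),
      hd.eventually (eventually_pairRate_le hκ₀ hκ α h0 h1 hmax (half_pos hε))] with N hN a b k hk
    linarith [abs_le.1 (a k hk), b _ (overlap_mem_admissible hN.1 hN.2 hk), (abs_le.1 (a k hk)).2]
  · intro ε hε
    -- For the lower bound it is enough to follow one sequence of overlaps approaching the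
    -- maximizer.
    obtain ⟨k, hk, hkt⟩ := exists_tendsto_overlap ht hd (hdN.mono fun N hN => hN.2.le)
    filter_upwards [hk, (tendsto_log_pairTerm hκ₀ hκ h0 h1 hd hw hk ht hkt).eventually
      (lt_mem_nhds (sub_lt_self _ hε))] with N a b
    exact ⟨k N, a, b.le⟩

end Sums

/-- `pairRate α κ₀ κ (ρ, ·)` attains its maximum. -/
lemma exists_max_pairRate {κ₀ κ ρ : ℝ} (hκ₀ : 0 < κ₀) (hκ : 0 < κ) (α : ℝ) (h0 : 0 < ρ)
    (h1 : ρ < 1) : ∃ t, (ρ, t) ∈ admissible ∧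
      ∀ s, (ρ, s) ∈ admissible → pairRate α κ₀ κ (ρ, s) ≤ pairRate α κ₀ κ (ρ, t) := by
  obtain ⟨δ, hδ, hδ0, hδ1⟩ := exists_margin h0 h1
  have hX : IsCompact (admissibleCore δ ∩ {p | p.1 = ρ}) :=
    (isCompact_admissibleCore hδ).inter_right (isClosed_eq continuous_fst continuous_const)
  -- Full overlap `t = ρ` is always admissible.
  have hne : (admissibleCore δ ∩ {p | p.1 = ρ}).Nonempty :=
    ⟨(ρ, ρ), ⟨⟨h0, h1, h0.le, le_rfl, by simp only; linarith⟩, hδ0.le, hδ1.le⟩, rfl⟩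
  obtain ⟨⟨r, t⟩, ⟨hp, rfl⟩, hmax⟩ := hX.exists_isMaxOn hne
    ((continuousOn_pairRate hκ₀ hκ α hδ).mono Set.inter_subset_left)
  exact ⟨t, hp.1, fun s hs => hmax ⟨⟨hs, hδ0.le, hδ1.le⟩, rfl⟩⟩

/-! ### Counting pairs of subsets by overlap -/

section Counting

/-- The number of `d`-sets meeting a given set in exactly `k` points. -/
lemma card_filter_card_inter {β : Type*} [Fintype β] [DecidableEq β] (s : Finset β) {d k : ℕ}
    (hk : k ≤ d) :
    ((Finset.powersetCard d Finset.univ).filter fun D => (s ∩ D).card = k).card =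
      s.card.choose k * (Fintype.card β - s.card).choose (d - k) := by
  rw [← Finset.card_compl, ← Finset.card_powersetCard, ← Finset.card_powersetCard,
    ← Finset.card_product]
  -- A set is recorded by its traces on `s` and on the complement of `s`.
  refine Finset.card_nbij' (fun D => (s ∩ D, sᶜ ∩ D)) (fun p => p.1 ∪ p.2) ?_ ?_ ?_ ?_
  · intro D hD
    simp only [Finset.coe_filter, Finset.mem_powersetCard, Set.mem_ofPred_eq] at hD
    simp only [Finset.coe_product, Set.mem_prod, Finset.mem_coe, Finset.mem_powersetCard]
    refine ⟨⟨Finset.inter_subset_left, hD.2⟩, Finset.inter_subset_left, ?_⟩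
    have h := Finset.card_inter_add_card_sdiff D s
    have e : sᶜ ∩ D = D \ s := by ext i; simp [and_comm]
    rw [Finset.inter_comm] at h
    rw [e]
    omega
  · rintro ⟨A, B⟩ hp
    simp only [Finset.coe_product, Set.mem_prod, Finset.mem_coe, Finset.mem_powersetCard] at hp
    obtain ⟨⟨hA, hAk⟩, hB, hBk⟩ := hp
    have hdisj : Disjoint A B := Finset.disjoint_of_subset_left hA
      (Finset.disjoint_of_subset_right hB disjoint_compl_right)
    simp only [Finset.coe_filter, Finset.mem_powersetCard, Set.mem_ofPred_eq]
    refine ⟨⟨Finset.subset_univ _, ?_⟩, ?_⟩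
    · rw [Finset.card_union_of_disjoint hdisj]
      omega
    · have : s ∩ (A ∪ B) = A := by
        ext i
        have h1 := @hA i
        have h2 := @hB i
        simp only [Finset.mem_compl] at h2
        simp only [Finset.mem_inter, Finset.mem_union]
        tauto
      rw [this, hAk]
  · intro D _
    ext i
    simp only [Finset.mem_inter, Finset.mem_union, Finset.mem_compl]
    tauto
  · rintro ⟨A, B⟩ hp
    simp only [Finset.coe_product, Set.mem_prod, Finset.mem_coe, Finset.mem_powersetCard] at hp
    obtain ⟨⟨hA, -⟩, hB, -⟩ := hp
    ext i <;>
    · have h1 := @hA i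
      have h2 := @hB i
      simp only [Finset.mem_compl] at h2
      simp only [Finset.mem_inter, Finset.mem_union, Finset.mem_compl]
      tauto

/-- Summing a function of the overlap over all pairs of `d`-subsets of `Fin N`. -/
lemma sum_sum_card_inter {N d : ℕ} (φ : ℕ → ℝ) :
    ∑ D ∈ Finset.powersetCard d (Finset.univ : Finset (Fin N)),
      ∑ D' ∈ Finset.powersetCard d (Finset.univ : Finset (Fin N)), φ (D ∩ D').card =
    ∑ k ∈ overlaps N d, pairCount N d k * φ k := by
  have inner : ∀ D ∈ Finset.powersetCard d (Finset.univ : Finset (Fin N)),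
      ∑ D' ∈ Finset.powersetCard d (Finset.univ : Finset (Fin N)), φ (D ∩ D').card =
      ∑ k ∈ overlaps N d, (d.choose k * (N - d).choose (d - k) : ℕ) * φ k := by
    intro D hD
    obtain ⟨-, hDd⟩ := Finset.mem_powersetCard.1 hD
    have hmaps : ∀ D' ∈ Finset.powersetCard d (Finset.univ : Finset (Fin N)),
        (D ∩ D').card ∈ Finset.range (d + 1) := by
      intro D' _
      rw [Finset.mem_range, ← hDd]
      exact Nat.lt_succ_of_le (Finset.card_le_card Finset.inter_subset_left)
    rw [← Finset.sum_fiberwise_of_maps_to hmaps, overlaps, Finset.sum_filter]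
    refine Finset.sum_congr rfl fun k hk => ?_
    have hk' : k ≤ d := Nat.lt_succ_iff.1 (Finset.mem_range.1 hk)
    have : ∑ D' ∈ (Finset.powersetCard d (Finset.univ : Finset (Fin N))).filter
        (fun D' => (D ∩ D').card = k), φ (D ∩ D').card =
        (d.choose k * (N - d).choose (d - k) : ℕ) * φ k := by
      rw [Finset.sum_congr rfl fun D' hD' => by rw [(Finset.mem_filter.1 hD').2],
        Finset.sum_const, card_filter_card_inter D hk', hDd, Fintype.card_fin, nsmul_eq_mul]
    rw [this]
    split_ifs with h
    · rfl
    -- Overlaps with `N + k < 2d` are impossible: the complement is too small, and the binomial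
    -- coefficient vanishes.
    · have hdN : d ≤ N := by simpa [hDd] using card_finset_fin_le D
      rw [Nat.choose_eq_zero_of_lt (show N - d < d - k by omega)]
      simp
  rw [Finset.sum_congr rfl inner, Finset.sum_const, Finset.card_powersetCard, Finset.card_univ,
    Fintype.card_fin, nsmul_eq_mul, Finset.mul_sum]
  refine Finset.sum_congr rfl fun k _ => ?_
  rw [pairCount]
  push_cast
  ring

end Counting

/-! ### Flips of the planted point and their Gaussian constraints -/

section Flips

variable {N M : ℕ}

/-- The vector `x` with the signs of the coordinates in `D` flipped. -/
def flip (x : Fin N → ℝ) (D : Finset (Fin N)) : Fin N → ℝ := fun i => if i ∈ D then -x i else x i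

lemma flip_empty (x : Fin N → ℝ) : flip x ∅ = x := by
  ext i
  simp [flip]

lemma mul_self_of_mem_hypercube {x : Fin N → ℝ} (hx : x ∈ hypercube N) (i : Fin N) :
    x i * x i = 1 := by
  rcases hx i with h | h <;> simp [h]

lemma flip_dotProduct_flip {x : Fin N → ℝ} (hx : x ∈ hypercube N) (D D' : Finset (Fin N)) :
    flip x D ⬝ᵥ flip x D' = N - 2 * D.card - 2 * D'.card + 4 * (D ∩ D').card := by
  have h : ∀ i, flip x D i * flip x D' i = 1 - 2 * (if i ∈ D then 1 else 0) -
      2 * (if i ∈ D' then 1 else 0) + 4 * (if i ∈ D ∩ D' then 1 else 0) := by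
    intro i
    have := mul_self_of_mem_hypercube hx i
    by_cases h1 : i ∈ D <;> by_cases h2 : i ∈ D' <;> simp [flip, h1, h2, this] <;> norm_num
  simp only [dotProduct, h, Finset.sum_add_distrib, Finset.sum_sub_distrib, ← Finset.mul_sum,
    Finset.sum_ite_mem, Finset.univ_inter]
  simp

lemma dotProduct_flip {x : Fin N → ℝ} (hx : x ∈ hypercube N) (D : Finset (Fin N)) :
    x ⬝ᵥ flip x D = N - 2 * D.card := by
  have := flip_dotProduct_flip hx ∅ D
  rw [flip_empty] at this
  simpa using this

lemma flip_mem_hypercube {x : Fin N → ℝ} (hx : x ∈ hypercube N) (D : Finset (Fin N)) :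
    flip x D ∈ hypercube N := by
  intro i
  rcases hx i with h | h <;> by_cases hi : i ∈ D <;> simp [flip, hi, h]

lemma ne_zero_of_mem_hypercube {x : Fin N → ℝ} (hx : x ∈ hypercube N) (i : Fin N) : x i ≠ 0 := by
  rcases hx i with h | h <;> simp [h]

lemma ne_flip_iff {x : Fin N → ℝ} (hx : x ∈ hypercube N) (D : Finset (Fin N)) (i : Fin N) :
    x i ≠ flip x D i ↔ i ∈ D := by
  have := ne_zero_of_mem_hypercube hx i
  by_cases hi : i ∈ D
  · simp [flip, hi, self_eq_neg, this]
  · simp [flip, hi]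

lemma flip_injective {x : Fin N → ℝ} (hx : x ∈ hypercube N) : Function.Injective (flip x) := by
  intro D D' h
  ext i
  rw [← ne_flip_iff hx D, ← ne_flip_iff hx D', h]

lemma hammingDist_flip {x : Fin N → ℝ} (hx : x ∈ hypercube N) (D : Finset (Fin N)) :
    hammingDist x (flip x D) = D.card := by
  unfold hammingDist
  congr 1
  ext i
  simpa using ne_flip_iff hx D i

lemma exists_eq_flip {x y : Fin N → ℝ} (hx : x ∈ hypercube N) (hy : y ∈ hypercube N) :
    ∃ D, y = flip x D := by
  classical
  refine ⟨Finset.univ.filter fun i => x i ≠ y i, ?_⟩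
  ext i
  rcases hx i with h | h <;> rcases hy i with h' | h' <;> simp [flip, h, h'] <;> norm_num

open Classical in
/-- The local partition function as a sum of indicators over sets of flipped coordinates. -/
lemma localZ_eq_sum {x : Fin N → ℝ} (hx : x ∈ hypercube N) (G : Fin M → Fin N → ℝ) (κ : ℝ)
    (hN : 0 < N) (d : ℕ) :
    (localZ G x κ ((d : ℝ) / N) : ℝ) =
      ∑ D ∈ Finset.powersetCard d (Finset.univ : Finset (Fin N)),
        if ∀ a, |G a ⬝ᵥ flip x D| ≤ κ * √(N : ℝ) then (1 : ℝ) else 0 := by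
  have hN' : (N : ℝ) ≠ 0 := by exact_mod_cast hN.ne'
  rw [← Finset.sum_filter, Finset.sum_const, nsmul_eq_mul, mul_one, localZ,
    ← Set.ncard_coe_finset, ← Set.ncard_image_of_injective _ (flip_injective hx)]
  congr 2
  ext y
  simp only [Set.mem_ofPred_eq, solutions, Finset.coe_filter, Finset.mem_powersetCard_univ,
    Set.mem_image]
  rw [mul_div_cancel₀ _ hN']
  constructor
  · rintro ⟨⟨hy, hs⟩, hd⟩
    obtain ⟨D, rfl⟩ := exists_eq_flip hx hy
    refine ⟨D, ⟨?_, hs⟩, rfl⟩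
    rw [← hammingDist_flip hx D]
    exact_mod_cast hd
  · rintro ⟨D, ⟨hD, hs⟩, rfl⟩
    exact ⟨⟨flip_mem_hypercube hx D, hs⟩, by rw [hammingDist_flip hx D, hD]⟩

/-- The normalized component of `flip x D` orthogonal to `x`. -/
def flipDir (x : Fin N → ℝ) (m : ℝ) (D : Finset (Fin N)) : Fin N → ℝ :=
  (1 / √(N : ℝ)) • (flip x D - m • x)

/-- This is where `x` drops out: the Gram entry depends on `D, D'` only through their overlap, with
`q = 1 - 4(ρ - t)`. -/
lemma flipDir_dotProduct_flipDir {x : Fin N → ℝ} (hx : x ∈ hypercube N) (hN : 0 < N) {d : ℕ}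
    {D D' : Finset (Fin N)} (hD : D.card = d) (hD' : D'.card = d) {m : ℝ}
    (hm : m = 1 - 2 * ((d : ℝ) / N)) :
    flipDir x m D ⬝ᵥ flipDir x m D' =
      1 - 4 * ((d : ℝ) / N - ((D ∩ D').card : ℝ) / N) - m ^ 2 := by
  have hN' : (0 : ℝ) < N := by exact_mod_cast hN
  have h1 := flip_dotProduct_flip hx D D'
  have h2 := dotProduct_flip hx D
  have h3 := dotProduct_flip hx D'
  have h4 := dotProduct_flip hx ∅
  rw [flip_empty] at h4
  have hs : 1 / √(N : ℝ) * (1 / √(N : ℝ)) = 1 / N := by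
    rw [div_mul_div_comm, one_mul, Real.mul_self_sqrt hN'.le]
  simp only [flipDir, smul_dotProduct, dotProduct_smul, sub_dotProduct, dotProduct_sub,
    smul_eq_mul, h1, h3, h4, dotProduct_comm _ x, h2, hD, hD']
  have e : ∀ c A B : ℝ, c * (c * A - m * (c * B)) = c * c * (A - m * B) := fun c A B => by ring
  rw [e, hs, hm]
  simp only [Finset.card_empty, Nat.cast_zero]
  field_simp
  ring

/-- The projection orthogonal to `x` is symmetric, so it can be moved from `g a` onto the flip,
where it produces `flipDir`. -/
lemma plantedG_dotProduct_flip {x : Fin N → ℝ} (hx : x ∈ hypercube N) (hN : 0 < N) {d : ℕ}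
    {D : Finset (Fin N)} (hD : D.card = d) (w : Fin M → ℝ) (g : Fin M → Fin N → ℝ) (a : Fin M) :
    plantedG x w g a ⬝ᵥ flip x D =
      √(N : ℝ) * ((1 - 2 * ((d : ℝ) / N)) * w a +
        flipDir x (1 - 2 * ((d : ℝ) / N)) D ⬝ᵥ g a) := by
  have hN' : (0 : ℝ) < N := by exact_mod_cast hN
  have hs : √(N : ℝ) * √(N : ℝ) = N := Real.mul_self_sqrt hN'.le
  have hs0 : √(N : ℝ) ≠ 0 := (Real.sqrt_pos.2 hN').ne'
  have h2 := dotProduct_flip hx D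
  rw [hD] at h2
  simp only [plantedG, add_dotProduct, smul_dotProduct, sub_mulVec, one_mulVec, smul_mulVec,
    sub_dotProduct, smul_eq_mul, flipDir, vecMulVec_mulVec, h2, dotProduct_comm (flip x D) (g a)]
  simp only [op_smul_eq_smul, smul_eq_mul]
  field_simp
  linear_combination (-(w a * (N - 2 * d))) * hs

lemma abs_plantedG_dotProduct_flip_le_iff {x : Fin N → ℝ} (hx : x ∈ hypercube N) (hN : 0 < N)
    {d : ℕ} {D : Finset (Fin N)} (hD : D.card = d) (w : Fin M → ℝ) (g : Fin M → Fin N → ℝ)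
    (a : Fin M) (κ : ℝ) :
    |plantedG x w g a ⬝ᵥ flip x D| ≤ κ * √(N : ℝ) ↔
      |(1 - 2 * ((d : ℝ) / N)) * w a + flipDir x (1 - 2 * ((d : ℝ) / N)) D ⬝ᵥ g a| ≤ κ := by
  have hs0 : 0 < √(N : ℝ) := Real.sqrt_pos.2 (by exact_mod_cast hN)
  rw [plantedG_dotProduct_flip hx hN hD, abs_mul, abs_of_pos hs0, mul_comm κ,
    mul_le_mul_iff_right₀ hs0]

/-- The probability that two given flips of `x` are both solutions. -/
lemma pi_real_both_solutions {x : Fin N → ℝ} (hx : x ∈ hypercube N) (hN : 0 < N) {d : ℕ}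
    {D D' : Finset (Fin N)} (hD : D.card = d) (hD' : D'.card = d) (w : Fin M → ℝ) (κ : ℝ) :
    (Measure.pi fun _ : Fin M => Measure.pi fun _ : Fin N => gaussianReal 0 1).real
      {g | (∀ a, |plantedG x w g a ⬝ᵥ flip x D| ≤ κ * √(N : ℝ)) ∧
        ∀ a, |plantedG x w g a ⬝ᵥ flip x D'| ≤ κ * √(N : ℝ)} =
      ∏ a, flipProb κ ((d : ℝ) / N, ((D ∩ D').card : ℝ) / N) (w a) := by
  set m := 1 - 2 * ((d : ℝ) / N) with hm
  have hset : {g : Fin M → Fin N → ℝ |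
        (∀ a, |plantedG x w g a ⬝ᵥ flip x D| ≤ κ * √(N : ℝ)) ∧
          ∀ a, |plantedG x w g a ⬝ᵥ flip x D'| ≤ κ * √(N : ℝ)} =
      Set.univ.pi fun a => {v : Fin N → ℝ | |m * w a + flipDir x m D ⬝ᵥ v| ≤ κ ∧
        |m * w a + flipDir x m D' ⬝ᵥ v| ≤ κ} := by
    ext g
    simp only [Set.mem_ofPred_eq, Set.mem_univ_pi, ← forall_and,
      abs_plantedG_dotProduct_flip_le_iff hx hN hD,
      abs_plantedG_dotProduct_flip_le_iff hx hN hD', hm]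
  rw [hset, measureReal_def, Measure.pi_pi, ENNReal.toReal_prod]
  refine Finset.prod_congr rfl fun a _ => ?_
  have h1 := flipDir_dotProduct_flipDir hx hN hD hD hm
  have h2 := flipDir_dotProduct_flipDir hx hN hD' hD' hm
  rw [Finset.inter_self, hD] at h1
  rw [Finset.inter_self, hD'] at h2
  exact (pairProb_eq_stdPi (flipDir x m D) (flipDir x m D') (by rw [h1]; ring) (by rw [h2]; ring)
    (flipDir_dotProduct_flipDir hx hN hD hD' hm)).symm

end Flips

/-! ### Conditional moments as explicit functions of the planted margins -/

/-- Conditional expectation given the middle one of three independent random variables, when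
integrating out the last one leaves no dependence on the first one. -/
lemma condExp_comap_of_map_eq_prod {Ω X W G : Type*} [MeasurableSpace Ω] [MeasurableSpace X]
    [MeasurableSpace W] [MeasurableSpace G] {P : Measure Ω} [IsProbabilityMeasure P]
    {μ : Measure X} {ν : Measure W} {τ : Measure G} [IsProbabilityMeasure μ]
    [IsProbabilityMeasure ν] [IsProbabilityMeasure τ] {x : Ω → X} {w : Ω → W} {g : Ω → G}
    (hx : Measurable x) (hw : Measurable w) (hg : Measurable g)
    (hmap : P.map (fun ω => (x ω, w ω, g ω)) = μ.prod (ν.prod τ)) {F : X × W × G → ℝ}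
    (hF : Measurable F) {C : ℝ} (hC : ∀ p, |F p| ≤ C) {Ψ : W → ℝ}
    (h : ∀ᵐ a ∂μ, ∀ b, ∫ c, F (a, b, c) ∂τ = Ψ b) :
    P[fun ω => F (x ω, w ω, g ω) | MeasurableSpace.comap w inferInstance] =ᵐ[P]
      fun ω => Ψ (w ω) := by
  have hxwg : Measurable fun ω => (x ω, w ω, g ω) := hx.prodMk (hw.prodMk hg)
  -- `Ψ` is the section integral at one typical point `a₀`, which gives its measurability and its
  -- bound.
  obtain ⟨a₀, ha₀⟩ := h.exists
  have hΨ : Measurable Ψ := by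
    have : Measurable fun b => ∫ c, F (a₀, b, c) ∂τ :=
      (StronglyMeasurable.integral_prod_right'
        (f := fun p : W × G => F (a₀, p)) (by fun_prop)).measurable
    convert this using 1
    ext b
    exact (ha₀ b).symm
  have hΨC : ∀ b, |Ψ b| ≤ C := by
    intro b
    rw [← ha₀ b]
    simpa using norm_integral_le_of_norm_le_const (μ := τ) (f := fun c => F (a₀, b, c))
      (ae_of_all _ fun c => hC (a₀, b, c))
  have hint : Integrable (fun ω => F (x ω, w ω, g ω)) P :=
    Integrable.of_bound (hF.comp hxwg).aestronglyMeasurable C (ae_of_all _ fun ω => hC _)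
  have hintΨ : Integrable (fun ω => Ψ (w ω)) P :=
    Integrable.of_bound (hΨ.comp hw).aestronglyMeasurable C (ae_of_all _ fun ω => hΨC _)
  refine (ae_eq_condExp_of_forall_setIntegral_eq hw.comap_le hint
    (fun s _ _ => hintΨ.integrableOn) ?_ ?_).symm
  · rintro s ⟨t, ht, rfl⟩ -
    have key : ∀ H : X × W × G → ℝ, Measurable H → (∀ p, |H p| ≤ C) →
        ∫ ω in w ⁻¹' t, H (x ω, w ω, g ω) ∂P =
          ∫ a, ∫ b, ∫ c, t.indicator (fun _ => (1 : ℝ)) b * H (a, b, c) ∂τ ∂ν ∂μ := by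
      intro H hH hHC
      have hmI : Measurable fun p : X × W × G => t.indicator (fun _ => (1 : ℝ)) p.2.1 * H p :=
        ((measurable_const.indicator ht).comp measurable_snd.fst).mul hH
      have hbI : ∀ p : X × W × G, ‖t.indicator (fun _ => (1 : ℝ)) p.2.1 * H p‖ ≤ C := by
        intro p
        have hC0 : 0 ≤ C := (abs_nonneg _).trans (hHC p)
        by_cases hp : p.2.1 ∈ t <;> simp [hp, hHC, hC0]
      rw [← integral_indicator (hw ht)]
      have e : (w ⁻¹' t).indicator (fun ω => H (x ω, w ω, g ω)) =
          fun ω => (fun p : X × W × G => t.indicator (fun _ => (1 : ℝ)) p.2.1 * H p)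
            (x ω, w ω, g ω) := by
        ext ω
        by_cases hω : w ω ∈ t <;> simp [hω]
      rw [e, ← integral_map hxwg.aemeasurable hmI.aestronglyMeasurable, hmap,
        integral_prod _ (Integrable.of_bound hmI.aestronglyMeasurable C (ae_of_all _ hbI))]
      refine integral_congr_ae (ae_of_all _ fun a => ?_)
      exact integral_prod _ (Integrable.of_bound
        (hmI.comp measurable_prodMk_left).aestronglyMeasurable C (ae_of_all _ fun p => hbI (a, p)))
    rw [key F hF hC, key (fun p => Ψ p.2.1) (by fun_prop) fun p => hΨC _]
    refine integral_congr_ae ?_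
    filter_upwards [h] with a ha
    refine integral_congr_ae (ae_of_all _ fun b => ?_)
    simp only [integral_const_mul, ha b]
    simp
  · exact (hΨ.comp (comap_measurable w)).aestronglyMeasurable

lemma hypercube_finite (N : ℕ) : (hypercube N).Finite := by
  have : hypercube N = Set.univ.pi fun _ => ({1, -1} : Set ℝ) := by
    ext x
    simp [hypercube]
  rw [this]
  exact Set.Finite.pi fun _ => Set.toFinite ({1, -1} : Set ℝ)

lemma hypercube_nonempty (N : ℕ) : (hypercube N).Nonempty := ⟨1, fun _ => Or.inl rfl⟩

section Moments

variable {N M : ℕ}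

/-- The set of Gaussian data for which `flip x D` is a solution. -/
def solutionEvent (κ : ℝ) (D : Finset (Fin N)) :
    Set ((Fin N → ℝ) × (Fin M → ℝ) × (Fin M → Fin N → ℝ)) :=
  {p | ∀ a, |plantedG p.1 p.2.1 p.2.2 a ⬝ᵥ flip p.1 D| ≤ κ * √(N : ℝ)}

lemma measurableSet_solutionEvent (κ : ℝ) (D : Finset (Fin N)) :
    MeasurableSet (solutionEvent (M := M) κ D) := by
  have hflip : ∀ i, Continuous
      fun p : (Fin N → ℝ) × (Fin M → ℝ) × (Fin M → Fin N → ℝ) => flip p.1 D i := by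
    intro i
    by_cases hi : i ∈ D <;> simp only [flip, hi, if_true, if_false] <;> fun_prop
  have hG : ∀ a i, Continuous fun p : (Fin N → ℝ) × (Fin M → ℝ) × (Fin M → Fin N → ℝ) =>
      plantedG p.1 p.2.1 p.2.2 a i := by
    intro a i
    simp only [plantedG, Pi.add_apply, Pi.smul_apply, smul_eq_mul, mulVec, dotProduct,
      Matrix.sub_apply, Matrix.smul_apply, vecMulVec_apply]
    fun_prop
  have hcont : ∀ a, Continuous fun p : (Fin N → ℝ) × (Fin M → ℝ) × (Fin M → Fin N → ℝ) =>
      |plantedG p.1 p.2.1 p.2.2 a ⬝ᵥ flip p.1 D| := by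
    intro a
    simp only [dotProduct]
    exact (continuous_finsetSum _ fun i _ => (hG a i).mul (hflip i)).abs
  have : solutionEvent (M := M) κ D = ⋂ a, {p : (Fin N → ℝ) × (Fin M → ℝ) × (Fin M → Fin N → ℝ) |
      |plantedG p.1 p.2.1 p.2.2 a ⬝ᵥ flip p.1 D| ≤ κ * √(N : ℝ)} := by
    ext p
    simp [solutionEvent]
  rw [this]
  exact MeasurableSet.iInter fun a => measurableSet_le (hcont a).measurable measurable_const

/-- The number of solutions at distance `d`, as a sum of indicators. -/
def flipCount (κ : ℝ) (d : ℕ) (p : (Fin N → ℝ) × (Fin M → ℝ) × (Fin M → Fin N → ℝ)) : ℝ :=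
  ∑ D ∈ Finset.powersetCard d (Finset.univ : Finset (Fin N)),
    (solutionEvent κ D).indicator (fun _ => (1 : ℝ)) p

lemma measurable_flipCount (κ : ℝ) (d : ℕ) : Measurable (flipCount (N := N) (M := M) κ d) := by
  unfold flipCount
  exact Finset.measurable_sum _ fun D _ =>
    measurable_const.indicator (measurableSet_solutionEvent κ D)

lemma abs_flipCount_le (κ : ℝ) (d : ℕ) (p : (Fin N → ℝ) × (Fin M → ℝ) × (Fin M → Fin N → ℝ)) :
    |flipCount κ d p| ≤ N.choose d := by
  refine (Finset.abs_sum_le_sum_abs _ _).trans ?_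
  refine (Finset.sum_le_card_nsmul _ _ 1 fun D _ => ?_).trans (by simp)
  by_cases h : p ∈ solutionEvent κ D <;> simp [h]

lemma localZ_eq_flipCount {x : Fin N → ℝ} (hx : x ∈ hypercube N) (hN : 0 < N) (w : Fin M → ℝ)
    (g : Fin M → Fin N → ℝ) (κ : ℝ) (d : ℕ) :
    (localZ (plantedG x w g) x κ ((d : ℝ) / N) : ℝ) = flipCount κ d (x, w, g) := by
  classical
  rw [localZ_eq_sum hx _ _ hN, flipCount]
  refine Finset.sum_congr rfl fun D _ => ?_
  rw [Set.indicator_apply]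
  exact if_congr Iff.rfl rfl rfl

/-- The standard Gaussian law of the disorder. -/
abbrev disorderLaw (N M : ℕ) : Measure (Fin M → Fin N → ℝ) :=
  Measure.pi fun _ => Measure.pi fun _ => gaussianReal 0 1

lemma integral_indicator_mul_indicator {x : Fin N → ℝ} (hx : x ∈ hypercube N) (hN : 0 < N)
    {d : ℕ} {D D' : Finset (Fin N)} (hD : D.card = d) (hD' : D'.card = d) (w : Fin M → ℝ) (κ : ℝ) :
    ∫ g, (solutionEvent κ D).indicator (fun _ => (1 : ℝ)) (x, w, g) *
      (solutionEvent κ D').indicator (fun _ => (1 : ℝ)) (x, w, g) ∂(disorderLaw N M) =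
      ∏ a, flipProb κ ((d : ℝ) / N, ((D ∩ D').card : ℝ) / N) (w a) := by
  have hmeas : MeasurableSet ((fun g : Fin M → Fin N → ℝ => (x, w, g)) ⁻¹'
      (solutionEvent κ D ∩ solutionEvent κ D')) :=
    ((measurableSet_solutionEvent κ D).inter (measurableSet_solutionEvent κ D')).preimage
      (by fun_prop)
  rw [← pi_real_both_solutions hx hN hD hD' w κ]
  have e : (fun g : Fin M → Fin N → ℝ =>
      (solutionEvent κ D).indicator (fun _ => (1 : ℝ)) (x, w, g) *
        (solutionEvent κ D').indicator (fun _ => (1 : ℝ)) (x, w, g)) =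
      ((fun g : Fin M → Fin N → ℝ => (x, w, g)) ⁻¹'
        (solutionEvent κ D ∩ solutionEvent κ D')).indicator fun _ => (1 : ℝ) := by
    ext g
    by_cases h1 : (x, w, g) ∈ solutionEvent κ D <;>
      by_cases h2 : (x, w, g) ∈ solutionEvent κ D' <;> simp [h1, h2]
  rw [e, integral_indicator_const _ hmeas, smul_eq_mul, mul_one]
  rfl

lemma integrable_indicator_mul_indicator (x : Fin N → ℝ) (D D' : Finset (Fin N))
    (w : Fin M → ℝ) (κ : ℝ) :
    Integrable (fun g => (solutionEvent κ D).indicator (fun _ => (1 : ℝ)) (x, w, g) *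
      (solutionEvent κ D').indicator (fun _ => (1 : ℝ)) (x, w, g)) (disorderLaw N M) := by
  refine Integrable.of_bound (C := 1) (Measurable.aestronglyMeasurable ?_) (ae_of_all _ fun g => ?_)
  · exact ((measurable_const.indicator (measurableSet_solutionEvent κ D)).comp
      (by fun_prop : Measurable fun g : Fin M → Fin N → ℝ => (x, w, g))).mul
      ((measurable_const.indicator (measurableSet_solutionEvent κ D')).comp
      (by fun_prop : Measurable fun g : Fin M → Fin N → ℝ => (x, w, g)))
  · by_cases h1 : (x, w, g) ∈ solutionEvent κ D <;>
      by_cases h2 : (x, w, g) ∈ solutionEvent κ D' <;> simp [h1, h2]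

/-- An indicator equals its square, so this is the diagonal `D = D'` of the pair computation. -/
lemma integral_flipCount {x : Fin N → ℝ} (hx : x ∈ hypercube N) (hN : 0 < N) (d : ℕ)
    (w : Fin M → ℝ) (κ : ℝ) :
    ∫ g, flipCount κ d (x, w, g) ∂(disorderLaw N M) = pairTerm κ w N d d := by
  have e : ∀ g : Fin M → Fin N → ℝ, flipCount κ d (x, w, g) =
      ∑ D ∈ Finset.powersetCard d (Finset.univ : Finset (Fin N)),
        (solutionEvent κ D).indicator (fun _ => (1 : ℝ)) (x, w, g) *
        (solutionEvent κ D).indicator (fun _ => (1 : ℝ)) (x, w, g) := by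
    intro g
    refine Finset.sum_congr rfl fun D _ => ?_
    by_cases h : (x, w, g) ∈ solutionEvent κ D <;> simp [h]
  simp only [e]
  rw [integral_finsetSum _ fun D _ => integrable_indicator_mul_indicator x D D w κ]
  rw [Finset.sum_congr rfl fun D hD => by
    rw [integral_indicator_mul_indicator hx hN (Finset.mem_powersetCard_univ.1 hD)
      (Finset.mem_powersetCard_univ.1 hD), Finset.inter_self, Finset.mem_powersetCard_univ.1 hD]]
  simp [pairTerm, pairCount]

lemma integral_flipCount_sq {x : Fin N → ℝ} (hx : x ∈ hypercube N) (hN : 0 < N) (d : ℕ)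
    (w : Fin M → ℝ) (κ : ℝ) :
    ∫ g, flipCount κ d (x, w, g) ^ 2 ∂(disorderLaw N M) =
      ∑ k ∈ overlaps N d, pairTerm κ w N d k := by
  simp only [flipCount, sq, Finset.sum_mul_sum]
  rw [integral_finsetSum _ fun D _ => integrable_finsetSum _ fun D' _ =>
    integrable_indicator_mul_indicator x D D' w κ]
  simp only [pairTerm]
  rw [← sum_sum_card_inter fun k => ∏ a, flipProb κ ((d : ℝ) / N, (k : ℝ) / N) (w a)]
  refine Finset.sum_congr rfl fun D hD => ?_
  rw [integral_finsetSum _ fun D' _ => integrable_indicator_mul_indicator x D D' w κ]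
  exact Finset.sum_congr rfl fun D' hD' =>
    integral_indicator_mul_indicator hx hN (Finset.mem_powersetCard_univ.1 hD)
      (Finset.mem_powersetCard_univ.1 hD') w κ

variable {Ω : Type*} [MeasurableSpace Ω] {P : Measure Ω} {κ₀ κ : ℝ}
  {x₀ : Ω → Fin N → ℝ} {w : Ω → Fin M → ℝ} {g : Ω → Fin M → Fin N → ℝ}

/-- Almost surely `x₀` lies on the hypercube, where the integral over the disorder is the same for
every `x₀`; conditioning on `w` alone therefore gives that common value. -/
lemma condMoment_ae_eq [IsProbabilityMeasure P] (hκ₀ : 0 < κ₀) (hpl : IsPlanted P κ₀ x₀ w g) (hN : 0 < N) (d k : ℕ)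
    {Ψ : (Fin M → ℝ) → ℝ} (hΨ : ∀ x ∈ hypercube N, ∀ b,
      ∫ c, flipCount κ d (x, b, c) ^ k ∂(disorderLaw N M) = Ψ b) :
    condMoment P x₀ w g κ ((d : ℝ) / N) k =ᵐ[P] fun ω => Ψ (w ω) := by
  have := isProbabilityMeasure_truncGaussian hκ₀
  have hpu : IsProbabilityMeasure (uniformOn (hypercube N)) :=
    isProbabilityMeasure_uniformOn (hypercube_finite N) (hypercube_nonempty N)
  have hcube : ∀ᵐ x ∂(uniformOn (hypercube N)), x ∈ hypercube N :=
    ae_cond_mem (hypercube_finite N).measurableSet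
  have hx₀ : ∀ᵐ ω ∂P, x₀ ω ∈ hypercube N := by
    have hm : Measurable fun ω => (x₀ ω, w ω, g ω) :=
      hpl.measurable_x₀.prodMk (hpl.measurable_w.prodMk hpl.measurable_g)
    refine ae_of_ae_map hm.aemeasurable (p := fun p => p.1 ∈ hypercube N) ?_
    rw [hpl.map_eq]
    exact Measure.quasiMeasurePreserving_fst.ae hcube
  have hcongr : (fun ω => (localZ (plantedG (x₀ ω) (w ω) (g ω)) (x₀ ω) κ ((d : ℝ) / N) : ℝ) ^ k)
      =ᵐ[P] fun ω => flipCount κ d (x₀ ω, w ω, g ω) ^ k := by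
    filter_upwards [hx₀] with ω hω
    rw [localZ_eq_flipCount hω hN]
  refine (condExp_congr_ae hcongr).trans ?_
  exact condExp_comap_of_map_eq_prod (F := fun p => flipCount κ d p ^ k)
    hpl.measurable_x₀ hpl.measurable_w hpl.measurable_g hpl.map_eq
    ((measurable_flipCount κ d).pow_const k) (C := (N.choose d : ℝ) ^ k)
    (fun p => by rw [abs_pow]; exact pow_le_pow_left₀ (abs_nonneg _) (abs_flipCount_le κ d p) k)
    (hcube.mono hΨ)

lemma map_w_eq (hκ₀ : 0 < κ₀) (hpl : IsPlanted P κ₀ x₀ w g) :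
    P.map w = Measure.pi fun _ => truncGaussian κ₀ := by
  have := isProbabilityMeasure_truncGaussian hκ₀
  have hpu : IsProbabilityMeasure (uniformOn (hypercube N)) :=
    isProbabilityMeasure_uniformOn (hypercube_finite N) (hypercube_nonempty N)
  have hm : Measurable fun ω => (x₀ ω, w ω, g ω) :=
    hpl.measurable_x₀.prodMk (hpl.measurable_w.prodMk hpl.measurable_g)
  have e : w = (fun p : (Fin N → ℝ) × (Fin M → ℝ) × (Fin M → Fin N → ℝ) => p.2.1) ∘
      fun ω => (x₀ ω, w ω, g ω) := rfl
  rw [e, ← Measure.map_map (by fun_prop) hm, hpl.map_eq]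
  have e2 : (fun p : (Fin N → ℝ) × (Fin M → ℝ) × (Fin M → Fin N → ℝ) => p.2.1) =
    Prod.fst ∘ Prod.snd := rfl
  rw [e2, ← Measure.map_map measurable_fst measurable_snd]
  change Measure.fst (Measure.snd _) = _
  simp

end Moments

/-! ### From laws of sign pairs to overlaps -/

lemma sum_units_prod (f : ℤˣ × ℤˣ → ℝ) :
    ∑ e, f e = f (1, 1) + f (1, -1) + (f (-1, 1) + f (-1, -1)) := by
  have hu : (Finset.univ : Finset ℤˣ) = {1, -1} := rfl
  have hne : (1 : ℤˣ) ≠ -1 := by decide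
  rw [Fintype.sum_prod_type]
  simp [hu, Finset.sum_pair hne]

/-- A pair law is determined by its means and its correlation. -/
lemma admissible_and_entropy_of_mem_pairLaws {m q : ℝ} (hm : m ∈ Set.Ioo (-1 : ℝ) 1)
    {p : ℤˣ × ℤˣ → ℝ} (hp : p ∈ pairLaws m q) :
    ((1 - m) / 2, (1 - 2 * m + q) / 4) ∈ admissible ∧
      entropy p = pairEntropy ((1 - m) / 2, (1 - 2 * m + q) / 4) := by
  obtain ⟨⟨hnn, hsum⟩, h1, h2, h3⟩ := hp
  rw [sum_units_prod] at hsum h1 h2 h3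
  simp only [Units.val_one, Units.val_neg, Int.cast_one, Int.cast_neg] at h1 h2 h3
  have e1 : p (1, 1) = 1 - 2 * ((1 - m) / 2) + (1 - 2 * m + q) / 4 := by linarith
  have e2 : p (1, -1) = (1 - m) / 2 - (1 - 2 * m + q) / 4 := by linarith
  have e3 : p (-1, 1) = (1 - m) / 2 - (1 - 2 * m + q) / 4 := by linarith
  have e4 : p (-1, -1) = (1 - 2 * m + q) / 4 := by linarith
  have n1 := hnn (1, 1)
  have n2 := hnn (1, -1)
  have n4 := hnn (-1, -1)
  refine ⟨⟨by simp only; linarith [hm.2], by simp only; linarith [hm.1], by simp only; linarith,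
    by simp only; linarith, by simp only; linarith⟩, ?_⟩
  rw [entropy, sum_units_prod, e1, e2, e3, e4, pairEntropy]
  ring

lemma pairLaws_nonempty {m q : ℝ}
    (h : ((1 - m) / 2, (1 - 2 * m + q) / 4) ∈ admissible) : (pairLaws m q).Nonempty := by
  obtain ⟨-, -, h2, h3, h4⟩ := h
  simp only at h2 h3 h4
  -- The Fourier expansion on `{-1,+1}²` with the prescribed means and correlation; admissibility is
  -- exactly nonnegativity of its values.
  refine ⟨fun e => (1 + ((e.1 : ℤ) : ℝ) * m + ((e.2 : ℤ) : ℝ) * m +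
    ((e.1 : ℤ) : ℝ) * ((e.2 : ℤ) : ℝ) * q) / 4, ⟨?_, ?_⟩, ?_, ?_, ?_⟩
  · rintro ⟨a, b⟩
    rcases Int.units_eq_one_or a with rfl | rfl <;> rcases Int.units_eq_one_or b with rfl | rfl <;>
      simp <;> linarith
  all_goals
    rw [sum_units_prod]
    simp only [Units.val_one, Units.val_neg, Int.cast_one, Int.cast_neg]
    ring

lemma pairRate_eq (α κ₀ κ m q : ℝ) :
    pairRate α κ₀ κ ((1 - m) / 2, (1 - 2 * m + q) / 4) =
      pairEntropy ((1 - m) / 2, (1 - 2 * m + q) / 4) + α * phi2 κ₀ κ m q := by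
  have e1 : 1 - 2 * ((1 - m) / 2) = m := by ring
  have e2 : 1 - 4 * ((1 - m) / 2 - (1 - 2 * m + q) / 4) = q := by ring
  simp only [pairRate, flipProb, e1, e2, phi2, pairProb]

/-- The affine substitution `t = (1 - 2m + q)/4 = P(θ₁ = θ₂ = -1)` matches the two parametrizations,
and the maximum of the entropy is over a single law. -/
lemma mem_secondMomentValues_iff {α κ₀ κ m : ℝ} (hm : m ∈ Set.Ioo (-1 : ℝ) 1) {v : ℝ} :
    v ∈ secondMomentValues α κ₀ κ m ↔
      ∃ t, ((1 - m) / 2, t) ∈ admissible ∧ v = pairRate α κ₀ κ ((1 - m) / 2, t) := by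
  constructor
  · rintro ⟨q, -, s, ⟨⟨p, hp, rfl⟩, -⟩, rfl⟩
    obtain ⟨hadm, hent⟩ := admissible_and_entropy_of_mem_pairLaws hm hp
    exact ⟨_, hadm, by rw [pairRate_eq, hent]⟩
  · rintro ⟨t, ht, rfl⟩
    obtain ⟨q, rfl⟩ : ∃ q, t = (1 - 2 * m + q) / 4 := ⟨4 * t - 1 + 2 * m, by ring⟩
    have ht' := ht
    obtain ⟨-, -, h2, h3, h4⟩ := ht'
    simp only at h2 h3 h4
    refine ⟨q, ⟨by linarith, by linarith⟩,
      pairEntropy ((1 - m) / 2, (1 - 2 * m + q) / 4), ⟨?_, ?_⟩, pairRate_eq α κ₀ κ m q⟩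
    · obtain ⟨p, hp⟩ := pairLaws_nonempty ht
      exact ⟨p, hp, (admissible_and_entropy_of_mem_pairLaws hm hp).2⟩
    · rintro _ ⟨p, hp, rfl⟩
      exact (admissible_and_entropy_of_mem_pairLaws hm hp).2.le

/-- At full overlap `q = 1`, so the two flips coincide, and the pair entropy and pair probability
become those of one point. -/
lemma pairRate_diagonal {α κ₀ κ m : ℝ} (hm : m ∈ Set.Ioo (-1 : ℝ) 1) :
    pairRate α κ₀ κ ((1 - m) / 2, (1 - m) / 2) = h m + α * phi1 κ₀ κ m := by
  have hm2 : m ^ 2 ≤ 1 := by nlinarith [hm.1, hm.2]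
  have e1 : 1 - 2 * ((1 - m) / 2) = m := by ring
  have e2 : 1 - 2 * ((1 - m) / 2) + (1 - m) / 2 = (1 + m) / 2 := by ring
  have e3 : (1 - 4 * ((1 - m) / 2 - (1 - m) / 2) : ℝ) = 1 := by ring
  simp only [pairRate, pairEntropy, flipProb, e2, e3, phi1]
  simp only [e1, pairProb_one hm2, sub_self, Real.negMulLog, h]
  ring

end SBP

end

/-! ### Assembly of the two limits -/

theorem theorem2 {Ω : Type*} [MeasurableSpace Ω] (P : Measure Ω) [IsProbabilityMeasure P]
    (α κ₀ κ m : ℝ) (hα : 0 < α) (hκ₀ : 0 < κ₀) (hκ : 0 < κ) (hm : m ∈ Set.Ioo (-1 : ℝ) 1)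
    (x₀ : (N : ℕ) → Ω → Fin N → ℝ)
    (w : (N : ℕ) → Ω → Fin ⌊α * (N : ℝ)⌋₊ → ℝ)
    (g : (N : ℕ) → Ω → Fin ⌊α * (N : ℝ)⌋₊ → Fin N → ℝ)
    (hplanted : ∀ N, SBP.IsPlanted P κ₀ (x₀ N) (w N) (g N))
    (d : ℕ → ℕ)
    (hd : Tendsto (fun N : ℕ => (d N : ℝ) / (N : ℝ)) atTop (𝓝 ((1 - m) / 2))) :
    (∀ᵐ ω ∂P,
      (∀ᶠ N : ℕ in atTop,
        0 < SBP.condMoment P (x₀ N) (w N) (g N) κ ((d N : ℝ) / (N : ℝ)) 1 ω) ∧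
      Tendsto (fun N : ℕ => (1 / (N : ℝ)) *
          Real.log (SBP.condMoment P (x₀ N) (w N) (g N) κ ((d N : ℝ) / (N : ℝ)) 1 ω))
        atTop (𝓝 (SBP.h m + α * SBP.phi1 κ₀ κ m))) ∧
    ∃ L : ℝ, IsGreatest (SBP.secondMomentValues α κ₀ κ m) L ∧
      ∀ᵐ ω ∂P,
        (∀ᶠ N : ℕ in atTop,
          0 < SBP.condMoment P (x₀ N) (w N) (g N) κ ((d N : ℝ) / (N : ℝ)) 2 ω) ∧
        Tendsto (fun N : ℕ => (1 / (N : ℝ)) *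
            Real.log (SBP.condMoment P (x₀ N) (w N) (g N) κ ((d N : ℝ) / (N : ℝ)) 2 ω))
          atTop (𝓝 L) := by
  have hρ0 : 0 < (1 - m) / 2 := by linarith [hm.2]
  have hρ1 : (1 - m) / 2 < 1 := by linarith [hm.1]
  have := SBP.isProbabilityMeasure_truncGaussian hκ₀
  have hw : ∀ᵐ ω ∂P, ∀ δ > 0, ∀ ε > 0, ∀ᶠ N : ℕ in atTop, ∀ p ∈ SBP.admissibleCore δ,
      |1 / (N : ℝ) * ∑ a, Real.log (SBP.flipProb κ p (w N ω a)) -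
        α * ∫ z, Real.log (SBP.flipProb κ p z) ∂(SBP.truncGaussian κ₀)| ≤ ε := by
    -- Countably many `δ` and `ε` suffice for a single null set, since `admissibleCore δ` grows as
    -- `δ` decreases.
    have hij : ∀ᵐ ω ∂P, ∀ i j : ℕ, ∀ᶠ N : ℕ in atTop,
        ∀ p ∈ SBP.admissibleCore (1 / ((i : ℝ) + 1)),
        |1 / (N : ℝ) * ∑ a, Real.log (SBP.flipProb κ p (w N ω a)) -
          α * ∫ z, Real.log (SBP.flipProb κ p z) ∂(SBP.truncGaussian κ₀)| ≤
            1 / ((j : ℝ) + 1) := by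
      rw [ae_all_iff]
      intro i
      rw [ae_all_iff]
      intro j
      exact SBP.ae_uniform_row_average hα (fun N => (hplanted N).measurable_w)
        (fun N => SBP.map_w_eq hκ₀ (hplanted N)) (SBP.ae_truncGaussian_mem_Icc κ₀)
        (SBP.isCompact_admissibleCore Nat.one_div_pos_of_nat)
        ((SBP.continuousOn_log_flipProb hκ).mono
          (Set.prod_mono_left (SBP.admissibleCore_subset _))) Nat.one_div_pos_of_nat
    filter_upwards [hij] with ω hω δ hδ ε hε
    obtain ⟨i, hi⟩ := exists_nat_one_div_lt hδ
    obtain ⟨j, hj⟩ := exists_nat_one_div_lt hε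
    filter_upwards [hω i j] with N hN p hp
    exact (hN p ⟨hp.1, hi.le.trans hp.2.1, by linarith [hp.2.2]⟩).trans hj.le
  have hdN := SBP.eventually_pos_and_lt hρ0 hρ1 hd
  obtain ⟨t, ht, hmax⟩ := SBP.exists_max_pairRate hκ₀ hκ α hρ0 hρ1
  have hfirst : ∀ᵐ ω ∂P, ∀ N : ℕ, 0 < N →
      SBP.condMoment P (x₀ N) (w N) (g N) κ ((d N : ℝ) / (N : ℝ)) 1 ω =
        SBP.pairTerm κ (w N ω) N (d N) (d N) := by
    rw [ae_all_iff]
    intro N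
    rw [eventually_imp_distrib_left]
    intro hN
    exact SBP.condMoment_ae_eq hκ₀ (hplanted N) hN (d N) 1
      (Ψ := fun b => SBP.pairTerm κ b N (d N) (d N)) fun x hx b => by
        simpa using SBP.integral_flipCount hx hN (d N) b κ
  have hsecond : ∀ᵐ ω ∂P, ∀ N : ℕ, 0 < N →
      SBP.condMoment P (x₀ N) (w N) (g N) κ ((d N : ℝ) / (N : ℝ)) 2 ω =
        ∑ k ∈ SBP.overlaps N (d N), SBP.pairTerm κ (w N ω) N (d N) k := by
    rw [ae_all_iff]
    intro N
    rw [eventually_imp_distrib_left]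
    intro hN
    exact SBP.condMoment_ae_eq hκ₀ (hplanted N) hN (d N) 2
      (Ψ := fun b => ∑ k ∈ SBP.overlaps N (d N), SBP.pairTerm κ b N (d N) k) fun x hx b =>
        SBP.integral_flipCount_sq hx hN (d N) b κ
  refine ⟨?_, SBP.pairRate α κ₀ κ ((1 - m) / 2, t), ⟨?_, ?_⟩, ?_⟩
  · filter_upwards [hw, hfirst] with ω hω hmom
    constructor
    · filter_upwards [hdN] with N hN
      rw [hmom N (hN.1.trans hN.2)]
      exact SBP.pairTerm_pos hκ _ hN.1 hN.2 (SBP.self_mem_overlaps hN.2.le)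
    -- The first moment is the single term with overlap `k = d`, so `t = ρ`.
    · have hlim := SBP.tendsto_log_pairTerm hκ₀ hκ hρ0 hρ1 hd hω (k := d) (t := (1 - m) / 2)
        (hdN.mono fun N hN => SBP.self_mem_overlaps hN.2.le)
        ⟨hρ0, hρ1, hρ0.le, le_rfl, by simp only; linarith [hm.1]⟩ hd
      rw [SBP.pairRate_diagonal hm] at hlim
      refine hlim.congr' ?_
      filter_upwards [eventually_gt_atTop 0] with N hN
      rw [hmom N hN]
  · exact (SBP.mem_secondMomentValues_iff hm).2 ⟨t, ht, rfl⟩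
  · rintro v hv
    obtain ⟨s, hs, rfl⟩ := (SBP.mem_secondMomentValues_iff hm).1 hv
    exact hmax s hs
  · filter_upwards [hw, hsecond] with ω hω hmom
    constructor
    · filter_upwards [hdN] with N hN
      rw [hmom N (hN.1.trans hN.2)]
      exact Finset.sum_pos (fun k hk => SBP.pairTerm_pos hκ _ hN.1 hN.2 hk)
        ⟨d N, SBP.self_mem_overlaps hN.2.le⟩
    · refine (SBP.tendsto_log_sum_pairTerm hκ₀ hκ hρ0 hρ1 hd hω ht hmax).congr' ?_
      filter_upwards [eventually_gt_atTop 0] with N hN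
      rw [hmom N hN]
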